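/- **Notation.** Write $\mathfrak X_{2d}=\Omega^{0,\bullet}_c(\mathbb C,T\mathbb C)$ for the compactly supported Dolbeault valued holomorphic vector fields on $\mathbb C$, with elements $\xi\,\partial_z$. Write $\mathfrak X'_{\mathcal N=2}$ for the compactly supported Dolbeault valued vector fields $$\sum_{j=1,2}(\xi_j+\varepsilon\xi_j')\tfrac{\partial}{\partial z_j}+(f+\varepsilon f')\tfrac{\partial}{\partial\varepsilon}$$ on $\mathbb C^{2|1}$, where $\varepsilon$ has degree $-1$, with differential $\bar\partial+[z_2\partial_\varepsilon,-]$. A quadratic functional on a graded Lie algebra $L$ is read as a Chevalley–Eilenberg cochain, i.e. as a function on $L[1]$, with the Koszul sign rule for total degrees. Consider the cochains $$\psi_{2d}(\xi\,\partial_z)=\frac1{2\pi i}\int_{\mathbb C}\partial_z\xi\wedge\partial(\partial_z\xi),\qquad \psi^i(\xi+\varepsilon\xi')=\frac1{(2\pi i)^2}\int_{\mathbb C^2}\operatorname{tr}(J\xi)\wedge\partial\operatorname{tr}(J\xi')\wedge dz_i\quad(i=1,2),$$ where $(J\xi)_{ij}=L_{\partial_{z_i}}\xi_j$ and $\psi^i$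 does not depend on the components $f,f'$ along $\partial_\varepsilon$. Let $\pi(z_1,z_2)=z_1$, and let $\rho:\mathbb C^2\to\mathbb C$ be a bump function along $z_2=0$: a smooth function for which there are open sets $U_1\supseteq\{z_2=0\}$ and $U_2\supseteq\overline{U_1}$ with $\rho=1$ on $U_1$, $\rho=0$ outside $U_2$, and $\overline{U_2}\cap\pi^{-1}(K)$ compact for every compact $K\subset\mathbb C$. Let $s_\rho=(s^{(1)}_\rho,s^{(2)}_\rho):\mathfrak X_{2d}\rightsquigarrow\mathfrak X'_{\mathcal N=2}$ be the $L_\infty$ map with components $$s_\rho^{(1)}(\xi\,\partial_z)=\rho\,\pi^*\xi\,\partial_{z_1}-\varepsilon\,\frac{\bar\partial\rho}{z_2}\wedge\pi^*\xi\,\partial_{z_1},\qquad s_\rho^{(2)}(\xi\,\partial_z,\lambda\,\partial_z)=\varepsilon\,\frac{\rho(\rho-1)}{z_2}\,\pi^*[\xi\,\partial_z,\lambda\,\partial_z].$$ **Proposition.** The following identities of cochains on $\mathfrak X_{2d}$ hold (in all arities): 1. $s_\rho^*\psi^2=-\tfrac12\,\psi_{2d}$; 2. $s_\rho^*\psi^1=0$,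 if $\rho$ does not depend on $z_1$. Consequently, if the two-dimensional cocycle is normalized as $\tfrac1{24}\psi_{2d}$, then for $c_{2d},c_{4d}\in\mathbb C$ one has $s_\rho^*(c_{4d}\,\psi^2)=c_{2d}\cdot\tfrac1{24}\psi_{2d}$ if and only if $c_{2d}=-12\,c_{4d}$. -/

import Mathlib

open scoped ContDiff

noncomputable section

namespace HigherVir

/-! ### Differential forms on `ℂ^d`, in coordinates -/

/-- The one-forms `dz_k = (k, false)` and `dz̄_k = (k, true)`, which generate the forms on `ℂ^d`. -/
abbrev Gen (d : ℕ) := Fin d × Bool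

/-- The position of a generator in the order `dz_1, dz̄_1, dz_2, dz̄_2, …`. -/
def Gen.pos {d : ℕ} (g : Gen d) : ℕ := 2 * (g.1 : ℕ) + (if g.2 then 1 else 0)

/-- A (mixed degree) complex differential form `∑_I σ_I e_I` on `ℂ^d`. Here `e_I` is the wedge
product of the generators in `I`, taken in the order `dz_1, dz̄_1, dz_2, dz̄_2, …`. -/
abbrev Form (d : ℕ) := Finset (Gen d) → (Fin d → ℂ) → ℂ

/-- The sign in `e_I ∧ e_J = ± e_(I ∪ J)`, for disjoint `I` and `J`. -/
def wedgeSign {d : ℕ} (I J : Finset (Gen d)) : ℤ :=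
  (-1) ^ ((I ×ˢ J).filter fun p => p.2.pos < p.1.pos).card

/-- The wedge product. -/
def wedge {d : ℕ} (σ η : Form d) : Form d := fun K z =>
  ∑ I ∈ K.powerset, (wedgeSign I (K \ I) : ℂ) * (σ I z * η (K \ I) z)

/-- A function, seen as a form of degree zero. -/
def fn {d : ℕ} (f : (Fin d → ℂ) → ℂ) : Form d := fun I => if I = ∅ then f else 0

/-- The one-form given by a generator. -/
def gen {d : ℕ} (g : Gen d) : Form d := fun I => if I = {g} then 1 else 0

/-- The product of a function and a form. -/
def fmul {d : ℕ} (f : (Fin d → ℂ) → ℂ) (σ : Form d) : Form d := fun I z => f z * σ I z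

/-- `∂f/∂z_k = (∂f/∂x_k - i ∂f/∂y_k) / 2`. -/
def dz {d : ℕ} (k : Fin d) (f : (Fin d → ℂ) → ℂ) (z : Fin d → ℂ) : ℂ :=
  (1 / 2) * (fderiv ℝ f z (Pi.single k 1) - Complex.I * fderiv ℝ f z (Pi.single k Complex.I))

/-- `∂f/∂z̄_k = (∂f/∂x_k + i ∂f/∂y_k) / 2`. -/
def dzbar {d : ℕ} (k : Fin d) (f : (Fin d → ℂ) → ℂ) (z : Fin d → ℂ) : ℂ :=
  (1 / 2) * (fderiv ℝ f z (Pi.single k 1) + Complex.I * fderiv ℝ f z (Pi.single k Complex.I))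

/-- The Lie derivative of a form along the coordinate vector field `∂/∂z_k`. -/
def lieDz {d : ℕ} (k : Fin d) (σ : Form d) : Form d := fun I => dz k (σ I)

/-- The Lie derivative of a form along the coordinate vector field `∂/∂z̄_k`. -/
def lieDzbar {d : ℕ} (k : Fin d) (σ : Form d) : Form d := fun I => dzbar k (σ I)

/-- The Dolbeault operator `∂ = ∑_k dz_k ∧ ∂/∂z_k`. -/
def del {d : ℕ} (σ : Form d) : Form d := ∑ k, wedge (gen (k, false)) (lieDz k σ)

/-- The Dolbeault operator `∂̄ = ∑_k dz̄_k ∧ ∂/∂z̄_k`. -/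
def delbar {d : ℕ} (σ : Form d) : Form d := ∑ k, wedge (gen (k, true)) (lieDzbar k σ)

/-- The integral over `ℂ^d` of the top degree part of a form, for the complex orientation:
`dz ∧ dz̄ = -2i dx ∧ dy`. -/
def integral {d : ℕ} (σ : Form d) : ℂ := (-2 * Complex.I) ^ d * ∫ z, σ Finset.univ z

/-! ### Compactly supported Dolbeault forms -/

/-- All coefficients are smooth. -/
def IsSmooth {d : ℕ} (σ : Form d) : Prop := ∀ I, ContDiff ℝ ∞ (σ I)

/-- The form is of type `(0, q)`. -/
def IsType {d : ℕ} (σ : Form d) (q : ℤ) : Prop :=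
  ∀ I, σ I ≠ 0 → (∀ g ∈ I, g.2 = true) ∧ (I.card : ℤ) = q

/-- The space `Ω_c^{0,q}(ℂ^d)` of smooth compactly supported `(0, q)`-forms. -/
def Dolb (d : ℕ) (q : ℤ) : Submodule ℂ (Form d) where
  carrier := {σ | IsSmooth σ ∧ (∀ I, HasCompactSupport (σ I)) ∧ IsType σ q}
  add_mem' := by
    rintro a b ⟨ha, ha', ha''⟩ ⟨hb, hb', hb''⟩
    refine ⟨fun I => (ha I).add (hb I), fun I => (ha' I).add (hb' I), fun I hI => ?_⟩
    by_cases h : a I = 0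
    · refine hb'' I fun h' => hI ?_
      simp [h, h']
    · exact ha'' I h
  zero_mem' := by
    refine ⟨fun I => contDiff_const, fun I => ?_, fun I hI => absurd rfl hI⟩
    exact HasCompactSupport.zero
  smul_mem' := by
    rintro c a ⟨ha, ha', ha''⟩
    refine ⟨fun I => contDiff_const.mul (ha I) (f := fun _ => c), fun I => ?_, fun I hI => ha'' I fun h => hI ?_⟩
    · exact (ha' I).smul_left (f := fun _ => c)
    · simp [h]

lemma contDiff_dz {d : ℕ} (k : Fin d) {f : (Fin d → ℂ) → ℂ} (hf : ContDiff ℝ ∞ f) :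
    ContDiff ℝ ∞ (dz k f) := by
  have h : ContDiff ℝ ∞ (fderiv ℝ f) := hf.fderiv_right le_rfl
  exact contDiff_const.mul ((h.clm_apply contDiff_const).sub
    (contDiff_const.mul (h.clm_apply contDiff_const)))

lemma contDiff_dzbar {d : ℕ} (k : Fin d) {f : (Fin d → ℂ) → ℂ} (hf : ContDiff ℝ ∞ f) :
    ContDiff ℝ ∞ (dzbar k f) := by
  have h : ContDiff ℝ ∞ (fderiv ℝ f) := hf.fderiv_right le_rfl
  exact contDiff_const.mul ((h.clm_apply contDiff_const).add
    (contDiff_const.mul (h.clm_apply contDiff_const)))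

lemma dz_zero {d : ℕ} (k : Fin d) : dz k (0 : (Fin d → ℂ) → ℂ) = 0 := by
  funext z
  simp [dz]

lemma dzbar_zero {d : ℕ} (k : Fin d) : dzbar k (0 : (Fin d → ℂ) → ℂ) = 0 := by
  funext z
  simp [dzbar]

lemma hasCompactSupport_dz {d : ℕ} (k : Fin d) {f : (Fin d → ℂ) → ℂ}
    (hf : HasCompactSupport f) : HasCompactSupport (dz k f) := by
  refine HasCompactSupport.intro hf fun z hz => ?_
  have : fderiv ℝ f z = 0 := fderiv_of_notMem_tsupport ℝ hz
  simp [dz, this]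

lemma dzbar_eq_zero_of_notMem {d : ℕ} (k : Fin d) {f : (Fin d → ℂ) → ℂ} {z : Fin d → ℂ}
    (hz : z ∉ tsupport f) : dzbar k f z = 0 := by
  have : fderiv ℝ f z = 0 := fderiv_of_notMem_tsupport ℝ hz
  simp [dzbar, this]

lemma isSmooth_wedge {d : ℕ} {σ η : Form d} (h : IsSmooth σ) (h' : IsSmooth η) :
    IsSmooth (wedge σ η) := fun _ =>
  ContDiff.sum fun I _ => contDiff_const.mul ((h I).mul (h' _))

lemma isType_wedge {d : ℕ} {σ η : Form d} {p q : ℤ} (h : IsType σ p) (h' : IsType η q) :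
    IsType (wedge σ η) (p + q) := by
  intro K hK
  obtain ⟨I, hI, h1, h2⟩ : ∃ I ∈ K.powerset, σ I ≠ 0 ∧ η (K \ I) ≠ 0 := by
    by_contra! hc
    refine hK ?_
    funext z
    refine Finset.sum_eq_zero fun I hI => ?_
    by_cases h0 : σ I = 0
    · simp [h0]
    · simp [hc I hI h0]
  obtain ⟨a1, a2⟩ := h I h1
  obtain ⟨b1, b2⟩ := h' _ h2
  have hIK := Finset.mem_powerset.1 hI
  refine ⟨fun g hg => ?_, ?_⟩
  · by_cases hgI : g ∈ I
    · exact a1 g hgI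
    · exact b1 g (Finset.mem_sdiff.2 ⟨hg, hgI⟩)
  · rw [← a2, ← b2, ← Finset.card_sdiff_add_card_eq_card hIK]
    push_cast
    ring

lemma isSmooth_gen {d : ℕ} (g : Gen d) : IsSmooth (gen g) := by
  intro I
  unfold gen
  split_ifs
  · exact contDiff_const
  · exact contDiff_const

lemma isType_gen {d : ℕ} (k : Fin d) : IsType (gen (k, true)) 1 := by
  intro I hI
  by_cases h : I = {(k, true)}
  · subst h
    simp
  · simp [gen, h] at hI

lemma isSmooth_fn {d : ℕ} {f : (Fin d → ℂ) → ℂ} (hf : ContDiff ℝ ∞ f) : IsSmooth (fn f) := by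
  intro I
  unfold fn
  split_ifs
  · exact hf
  · exact contDiff_const

lemma isType_fn {d : ℕ} (f : (Fin d → ℂ) → ℂ) : IsType (fn f) 0 := by
  intro I hI
  by_cases h : I = ∅
  · simp [h]
  · simp [fn, h] at hI

lemma isSmooth_delbar {d : ℕ} {σ : Form d} (h : IsSmooth σ) : IsSmooth (delbar σ) := by
  intro I
  have he : delbar σ I = fun z => ∑ k, wedge (gen (k, true)) (lieDzbar k σ) I z := by
    funext z
    simp [delbar]
  rw [he]
  exact ContDiff.sum fun k _ =>
    isSmooth_wedge (isSmooth_gen _) (fun J => contDiff_dzbar k (h J)) I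

lemma isType_delbar {d : ℕ} {σ : Form d} {q : ℤ} (h : IsType σ q) :
    IsType (delbar σ) (1 + q) := by
  intro I hI
  obtain ⟨k, hk⟩ : ∃ k, wedge (gen (k, true)) (lieDzbar k σ) I ≠ 0 := by
    by_contra! hc
    refine hI ?_
    simp [delbar, hc]
  refine isType_wedge (isType_gen k) (fun J hJ => h J fun h0 => hJ ?_) I hk
  simp [lieDzbar, h0, dzbar_zero]

lemma delbar_fn_eq_zero {d : ℕ} {f : (Fin d → ℂ) → ℂ} {z : Fin d → ℂ}
    (hz : ∀ k, dzbar k f z = 0) (I : Finset (Gen d)) : delbar (fn f) I z = 0 := by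
  simp only [delbar, Finset.sum_apply, wedge]
  refine Finset.sum_eq_zero fun k _ => Finset.sum_eq_zero fun J _ => ?_
  have : lieDzbar k (fn f) (I \ J) z = 0 := by
    unfold lieDzbar fn
    split_ifs
    · exact hz k
    · simp [dzbar_zero]
  simp [this]

lemma wedge_mem {d : ℕ} {p q : ℤ} {σ η : Form d} (h : σ ∈ Dolb d p) (h' : η ∈ Dolb d q) :
    wedge σ η ∈ Dolb d (p + q) := by
  obtain ⟨h1, h2, h3⟩ := h
  obtain ⟨h1', -, h3'⟩ := h'
  refine ⟨isSmooth_wedge h1 h1', fun K => ?_, isType_wedge h3 h3'⟩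
  have hc : IsCompact (⋃ I ∈ K.powerset, tsupport (σ I)) :=
    K.powerset.isCompact_biUnion fun I _ => h2 I
  refine HasCompactSupport.intro hc fun z hz => Finset.sum_eq_zero fun I hI => ?_
  have : σ I z = 0 := image_eq_zero_of_notMem_tsupport fun h => hz (Set.mem_biUnion hI h)
  simp [this]

lemma lieDz_mem {d : ℕ} (k : Fin d) {q : ℤ} {σ : Form d} (h : σ ∈ Dolb d q) :
    lieDz k σ ∈ Dolb d q := by
  refine ⟨fun I => contDiff_dz k (h.1 I), fun I => hasCompactSupport_dz k (h.2.1 I),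
    fun I hI => h.2.2 I fun h0 => hI ?_⟩
  simp [lieDz, h0, dz_zero]

/-! ### Cochains and pullback along `L_∞` maps

A Chevalley–Eilenberg cochain on a graded Lie algebra `L` is a function on `L[1]`: it consists of
graded symmetric multilinear functions of `n` elements of `L[1]`, for all `n`. It is recorded
through its values on finite lists of homogeneous elements of `L` (the arity is the length of the
list); an element of degree `p` of `L` has degree `p - 1` in `L[1]`. -/

/-- Cochains on a graded vector space `L`, as functions of lists of homogeneous elements. -/
abbrev Cochain (L : ℤ → Type) := List (Σ p, L p) → ℂ

/-- The cochain given by the quadratic functional `x ↦ K(x, x)` on `L[1]`: the graded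
symmetrization (full polarization) of the bilinear function `K` on `L[1]`, in arity two. -/
def quadratic {L : ℤ → Type} (K : ∀ p q : ℤ, L p → L q → ℂ) : Cochain L
  | [x, y] => K x.1 y.1 x.2 y.2 + (-1 : ℂ) ^ ((x.1 - 1) * (y.1 - 1)) * K y.1 x.1 y.2 x.2
  | _ => 0

/-- The Taylor coefficients `L[1] → L'[1]` and `L[1] ⊗ L[1] → L'[1]` (both of degree zero) of an
`L_∞` map without components of arity three or more. -/
structure Taylor (L L' : ℤ → Type) where
  one : ∀ p : ℤ, L p → L' p
  two : ∀ p q : ℤ, L p → L q → L' (p + q - 1)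

/-- The pullback of cochains along the `L_∞` map with given Taylor coefficients: the sum over all
partitions of the arguments into blocks of one or two elements, where the Taylor coefficients are
applied to the blocks, with the Koszul sign in `L[1]`. The first argument `x` is either a block by
itself, or forms a block with some later argument, which has to be moved next to `x`. -/
def pullback {L L' : ℤ → Type} (s : Taylor L L') (Φ : Cochain L') : Cochain L
  | [] => Φ []
  | x :: xs =>
    pullback s (fun l => Φ (⟨x.1, s.one x.1 x.2⟩ :: l)) xs +
      ∑ j : Fin xs.length,
        (-1 : ℂ) ^ (((xs.get j).1 - 1) * ((xs.take j).map fun y => y.1 - 1).sum) *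
          pullback s (fun l => Φ (⟨_, s.two x.1 (xs.get j).1 x.2 (xs.get j).2⟩ :: l))
            (xs.eraseIdx j)
  termination_by xs => xs.length
  decreasing_by
    · simp
    · simp only [List.length_cons]
      exact Nat.lt_succ_of_le (List.length_eraseIdx_le _ _)

/-! ### Dolbeault valued vector fields on `ℂ` and the Virasoro cochain -/

/-- The degree `p` part `Ω_c^{0,p}(ℂ, Tℂ)` of the compactly supported sections of the local Lie
algebra of holomorphic vector fields on `ℂ`; the form `α` stands for `α ∂/∂z`. -/
abbrev VF1 (p : ℤ) : Type := Dolb 1 p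

/-- The Lie bracket `[α ∂/∂z, β ∂/∂z] = (α ∧ ∂_z β - (-1)^{pq} β ∧ ∂_z α) ∂/∂z`. -/
def bracket {p q : ℤ} (α : VF1 p) (β : VF1 q) : VF1 (p + q) :=
  ⟨wedge α.1 (lieDz 0 β.1), wedge_mem α.2 (lieDz_mem 0 β.2)⟩ -
    (-1 : ℂ) ^ (p * q) •
      ⟨wedge β.1 (lieDz 0 α.1), add_comm q p ▸ wedge_mem β.2 (lieDz_mem 0 α.2)⟩

/-- `(1 / 2πi) ∫ ∂_z α ∧ ∂(∂_z β)`. -/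
def psi2dIntegral {p q : ℤ} (α : VF1 p) (β : VF1 q) : ℂ :=
  1 / (2 * Real.pi * Complex.I) * integral (wedge (lieDz 0 α.1) (del (lieDz 0 β.1)))

/-- The cochain `ψ_2d : α ∂/∂z ↦ (1 / 2πi) ∫ ∂_z α ∧ ∂(∂_z α)`.

The argument of this functional on `L[1]` is a sum of terms `αθ`, where `α` is of degree `p` and
`θ` is a formal parameter of degree `1 - p`. The sign is the one which arises when the parameters
in `∂_z α θ ∧ ∂(∂_z β θ')` are moved to the right. -/
def psi2d : Cochain VF1 :=
  quadratic fun p q α β => (-1 : ℂ) ^ ((p - 1) * (q + 1)) * psi2dIntegral α β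

/-! ### Dolbeault valued vector fields on `ℂ^{2|1}` and the higher Virasoro cochains -/

/-- The degree `p` part of the compactly supported sections over `ℂ²` of the local Lie algebra of
`N = 2` extended holomorphic vector fields, that is, the vector fields
`∑_j (ξ_j + ε ξ'_j) ∂/∂z_j + (f + ε f') ∂/∂ε`
with coefficients in Dolbeault forms. Here `ε` is of degree `-1`, and `∂/∂ε` of degree `1`. The
deformation by `z_2 ∂/∂ε` has the same underlying graded vector space. -/
structure VF2 (p : ℤ) where
  /-- the coefficients `ξ_j` -/
  xi : Fin 2 → Dolb 2 p
  /-- the coefficients `ξ'_j` -/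
  xi' : Fin 2 → Dolb 2 (p + 1)
  /-- the coefficient `f` -/
  f : Dolb 2 (p - 1)
  /-- the coefficient `f'` -/
  f' : Dolb 2 p

instance (p : ℤ) : SMul ℂ (VF2 p) := ⟨fun c X => ⟨c • X.xi, c • X.xi', c • X.f, c • X.f'⟩⟩

/-- The Jacobian `(J ξ)_{ij} = L_{∂/∂z_i} ξ_j`, a matrix of Dolbeault forms. -/
def jacobian {p : ℤ} (ξ : Fin 2 → Dolb 2 p) : Matrix (Fin 2) (Fin 2) (Form 2) :=
  Matrix.of fun i j => lieDz i (ξ j).1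

/-- `(1 / (2πi)²) ∫ tr(J ξ) ∧ ∂ tr(J η') ∧ dz_i`, for `X = ξ + ε ξ' + …` and
`Y = η + ε η' + …`. -/
def psiIntegral (i : Fin 2) {p q : ℤ} (X : VF2 p) (Y : VF2 q) : ℂ :=
  1 / (2 * Real.pi * Complex.I) ^ 2 *
    integral (wedge (wedge (jacobian X.xi).trace (del (jacobian Y.xi').trace)) (gen (i, false)))

/-- The cochain `ψ^i : ξ + ε ξ' ↦ (1 / (2πi)²) ∫ tr(J ξ) ∧ ∂ tr(J ξ') ∧ dz_i`.

Indices of coordinates start at `0`: `psi 0` is `ψ^1` (with `dz_1`) and `psi 1` is `ψ^2` (with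
`dz_2`). The sign arises as for `psi2d`, when the formal parameters `θ`, `θ'` of degrees `1 - p`, `1 - q`
in `tr(J ξ) θ ∧ ∂ tr(J η') θ' ∧ dz_i` are moved to the right; here `η'` is of form degree
`q + 1`. -/
def psi (i : Fin 2) : Cochain VF2 :=
  quadratic fun p q X Y =>
    (-1 : ℂ) ^ ((p - 1) * (q + 2) + (p - 1) + (q - 1)) * psiIntegral i X Y

/-! ### Bump functions along `z_2 = 0` and the `L_∞` map `s_ρ` -/

/-- A bump function along `z_2 = 0`: a smooth function on `ℂ²` which is `1` on an open
neighbourhood `U₁` of `{z_2 = 0}` and `0` outside an open set `U₂` containing the closure of `U₁`,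
where the closure of `U₂` is proper over the `z_1`-plane. -/
structure Bump where
  toFun : (Fin 2 → ℂ) → ℂ
  smooth : ContDiff ℝ ∞ toFun
  exists_nhds : ∃ U₁ U₂ : Set (Fin 2 → ℂ), IsOpen U₁ ∧ IsOpen U₂ ∧ {z | z 1 = 0} ⊆ U₁ ∧
    closure U₁ ⊆ U₂ ∧ (∀ z ∈ U₁, toFun z = 1) ∧ (∀ z ∉ U₂, toFun z = 0) ∧
    ∀ K : Set ℂ, IsCompact K → IsCompact (closure U₂ ∩ {z | z 0 ∈ K})

/-- The pullback `π^* α` of a form along the projection `π : ℂ² → ℂ`, `(z_1, z_2) ↦ z_1`. -/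
def pull (α : Form 1) : Form 2 := fun K z =>
  ∑ I, if K = I.image (fun g => ((0 : Fin 2), g.2)) then α I (fun _ => z 0) else 0

lemma isSmooth_pull {α : Form 1} (h : IsSmooth α) : IsSmooth (pull α) := by
  intro K
  refine ContDiff.sum fun I _ => ?_
  split_ifs
  · exact (h I).comp (contDiff_pi.2 fun _ => contDiff_apply ℝ ℂ (0 : Fin 2))
  · exact contDiff_const

lemma isType_pull {α : Form 1} {q : ℤ} (h : IsType α q) : IsType (pull α) q := by
  intro K hK
  obtain ⟨I, rfl, hI⟩ : ∃ I, K = Finset.image (fun g : Gen 1 => ((0 : Fin 2), g.2)) I ∧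
      α I ≠ 0 := by
    by_contra! hc
    refine hK ?_
    funext z
    refine Finset.sum_eq_zero fun I _ => ?_
    split_ifs with h0
    · simp [hc I h0]
    · rfl
  obtain ⟨h1, h2⟩ := h I hI
  refine ⟨fun g hg => ?_, ?_⟩
  · obtain ⟨g', hg', rfl⟩ := Finset.mem_image.1 hg
    exact h1 g' hg'
  · rw [← h2, Finset.card_image_of_injective]
    rintro ⟨a, b⟩ ⟨a', b'⟩ hab
    simp only [Prod.mk.injEq, true_and] at hab
    exact Prod.ext (Subsingleton.elim _ _) hab

namespace Bump

variable (ρ : Bump)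

lemma isCompact_tsupport {K : Set ℂ} (hK : IsCompact K) :
    IsCompact (tsupport ρ.toFun ∩ {z | z 0 ∈ K}) := by
  obtain ⟨U₁, U₂, -, -, -, -, -, h0, hc⟩ := ρ.exists_nhds
  refine (hc K hK).of_isClosed_subset ?_ ?_
  · exact (isClosed_tsupport _).inter (hK.isClosed.preimage (continuous_apply 0))
  · refine Set.inter_subset_inter_left _ (closure_mono fun z hz => ?_)
    by_contra h
    exact hz (h0 z h)

/-- A product of a pulled back compactly supported form and a form which is supported where `ρ` is
has compact support. -/
lemma hasCompactSupport_wedge {σ : Form 2} (hσ : ∀ I, ∀ z ∉ tsupport ρ.toFun, σ I z = 0)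
    {α : Form 1} (hα : ∀ I, HasCompactSupport (α I)) (K : Finset (Gen 2)) :
    HasCompactSupport (wedge σ (pull α) K) := by
  have hS : IsCompact (⋃ I, (fun w : Fin 1 → ℂ => w 0) '' tsupport (α I)) :=
    isCompact_iUnion fun I => (show IsCompact (tsupport (α I)) from hα I).image (continuous_apply 0)
  refine HasCompactSupport.intro (ρ.isCompact_tsupport hS) fun z hz => ?_
  refine Finset.sum_eq_zero fun I _ => ?_
  by_cases h : z ∈ tsupport ρ.toFun
  · have : pull α (K \ I) z = 0 := by
      refine Finset.sum_eq_zero fun J _ => ?_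
      have hJ : α J (fun _ => z 0) = 0 := by
        refine image_eq_zero_of_notMem_tsupport fun h' => hz ⟨h, ?_⟩
        exact Set.mem_iUnion.2 ⟨J, _, h', rfl⟩
      simp [hJ]
    simp [this]
  · simp [hσ I z h]

lemma contDiff_div {g : (Fin 2 → ℂ) → ℂ} (hg : ContDiff ℝ ∞ g)
    (h0 : ∀ U : Set (Fin 2 → ℂ), IsOpen U → (∀ z ∈ U, ρ.toFun z = 1) → ∀ z ∈ U, g z = 0) :
    ContDiff ℝ ∞ fun z => g z / z 1 := by
  obtain ⟨U₁, U₂, hU, -, hs, -, h1, -, -⟩ := ρ.exists_nhds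
  refine contDiff_iff_contDiffAt.2 fun z => ?_
  by_cases hz : z 1 = 0
  · refine (contDiffAt_const (c := (0 : ℂ))).congr_of_eventuallyEq ?_
    filter_upwards [hU.mem_nhds (hs hz)] with w hw
    simp [h0 U₁ hU h1 w hw]
  · simp only [div_eq_mul_inv]
    exact hg.contDiffAt.mul ((contDiff_apply ℝ ℂ (1 : Fin 2)).contDiffAt.inv hz)

lemma delbar_eq_zero_of_notMem {z : Fin 2 → ℂ} (hz : z ∉ tsupport ρ.toFun)
    (I : Finset (Gen 2)) : delbar (fn ρ.toFun) I z = 0 :=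
  delbar_fn_eq_zero (fun k => dzbar_eq_zero_of_notMem k hz) I

/-- The form `∂̄ρ / z_2`, of type `(0, 1)`; it vanishes near `z_2 = 0`. -/
def delbarDiv : Form 2 := fun I z => delbar (fn ρ.toFun) I z / z 1

/-- The function `ρ (ρ - 1) / z_2`; it vanishes near `z_2 = 0`. -/
def homotopy : (Fin 2 → ℂ) → ℂ := fun z => ρ.toFun z * (ρ.toFun z - 1) / z 1

lemma isSmooth_delbarDiv : IsSmooth ρ.delbarDiv := fun I =>
  ρ.contDiff_div (isSmooth_delbar (isSmooth_fn ρ.smooth) I) fun U hU h z hz => by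
    refine delbar_fn_eq_zero (fun k => ?_) I
    have he : ρ.toFun =ᶠ[nhds z] fun _ => 1 := by
      filter_upwards [hU.mem_nhds hz] with w hw using h w hw
    simp [dzbar, he.fderiv_eq]

lemma isType_delbarDiv : IsType ρ.delbarDiv 1 := fun I hI =>
  isType_delbar (isType_fn ρ.toFun) I fun h => hI <| by
    funext z
    simp [delbarDiv, h]

lemma contDiff_homotopy : ContDiff ℝ ∞ ρ.homotopy :=
  ρ.contDiff_div (ρ.smooth.mul (ρ.smooth.sub contDiff_const)) fun U _ h z hz => by simp [h z hz]

lemma fn_eq_zero {h : (Fin 2 → ℂ) → ℂ} (hh : ∀ z ∉ tsupport ρ.toFun, h z = 0)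
    (I : Finset (Gen 2)) (z : Fin 2 → ℂ) (hz : z ∉ tsupport ρ.toFun) : fn h I z = 0 := by
  unfold fn
  split_ifs
  · exact hh z hz
  · rfl

/-- `h π^* α`, for a function `h` which is supported where `ρ` is. -/
lemma wedge_fn_mem {h : (Fin 2 → ℂ) → ℂ} (hs : ContDiff ℝ ∞ h)
    (hh : ∀ z ∉ tsupport ρ.toFun, h z = 0) {q : ℤ} (α : VF1 q) :
    wedge (fn h) (pull α.1) ∈ Dolb 2 q := by
  refine ⟨isSmooth_wedge (isSmooth_fn hs) (isSmooth_pull α.2.1),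
    ρ.hasCompactSupport_wedge (ρ.fn_eq_zero hh) α.2.2.1, ?_⟩
  simpa using isType_wedge (isType_fn h) (isType_pull α.2.2.2)

/-- The form `ρ π^* α`. -/
def cut {q : ℤ} (α : VF1 q) : Dolb 2 q :=
  ⟨wedge (fn ρ.toFun) (pull α.1),
    ρ.wedge_fn_mem ρ.smooth (fun _ hz => image_eq_zero_of_notMem_tsupport hz) α⟩

/-- The form `(∂̄ρ / z_2) ∧ π^* α`. -/
def cut' {q : ℤ} (α : VF1 q) : Dolb 2 (q + 1) :=
  ⟨wedge ρ.delbarDiv (pull α.1), isSmooth_wedge ρ.isSmooth_delbarDiv (isSmooth_pull α.2.1),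
    ρ.hasCompactSupport_wedge
      (fun I z hz => by simp [delbarDiv, ρ.delbar_eq_zero_of_notMem hz]) α.2.2.1,
    add_comm 1 q ▸ isType_wedge ρ.isType_delbarDiv (isType_pull α.2.2.2)⟩

/-- The form `(ρ (ρ - 1) / z_2) π^* α`. -/
def cutHomotopy {q : ℤ} (α : VF1 q) : Dolb 2 q :=
  ⟨wedge (fn ρ.homotopy) (pull α.1),
    ρ.wedge_fn_mem ρ.contDiff_homotopy
      (fun _ hz => by simp [homotopy, image_eq_zero_of_notMem_tsupport hz]) α⟩

/-- The linear component
`s_ρ^{(1)} (α ∂/∂z) = ρ π^* α ∂/∂z_1 - ε (∂̄ρ / z_2) ∧ π^* α ∂/∂z_1`. -/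
def s1 {p : ℤ} (α : VF1 p) : VF2 p where
  xi := ![ρ.cut α, 0]
  xi' := ![-ρ.cut' α, 0]
  f := 0
  f' := 0

/-- The quadratic component
`s_ρ^{(2)} (α ∂/∂z, β ∂/∂z) = ε (ρ (ρ - 1) / z_2) π^* [α ∂/∂z, β ∂/∂z]`, of degree `-1`. -/
def s2 {p q : ℤ} (α : VF1 p) (β : VF1 q) : VF2 (p + q - 1) where
  xi := 0
  xi' := ![⟨(ρ.cutHomotopy (bracket α β)).1, by
    rw [sub_add_cancel]
    exact (ρ.cutHomotopy (bracket α β)).2⟩, 0]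
  f := 0
  f' := 0

/-- The Taylor coefficients of the `L_∞` map `s_ρ = (s_ρ^{(1)}, s_ρ^{(2)})`. The sign translates
the degree `-1` map `s_ρ^{(2)}` into a degree zero map of the shifted spaces: as a map of formal
parameters of total degree one, `s_ρ` is `X ↦ s_ρ^{(1)}(X) - s_ρ^{(2)}(X, X) / 2`. -/
def s : Taylor VF1 VF2 where
  one _ α := ρ.s1 α
  two p q α β := (-(-1 : ℂ) ^ ((p - 1) * q)) • ρ.s2 α β

end Bump

end HigherVir

end

/-! Write `S` for the coefficient `∂̄_2 ρ / z_2` of `dz̄_2` in `∂̄ρ / z_2` (`ratio`); in the code,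
index `0` is `z_1` and index `1` is `z_2`.

No term with `s_ρ^{(2)}` contributes: this component only feeds the `ξ'` slot, and both its value
and `ρ π^*ξ` are free of `dz̄_2`, so the integrand cannot reach top degree (`Lacks`,
`pullback_psi`). What remains is `ψ^i` on two values of `s_ρ^{(1)}`. By type, only a function `a`
paired with a form `b dz̄` matters (`eq_of_eq_zero_one`).

For `ψ^2` the factor `dz_2` leaves only `∂_1`, and the value is a multiple of the integral of
`∂_1(ρb) ∂_1²(Sa) - ∂_1(ρa) ∂_1²(Sb)`. With `W = ab' - a'b` and `V = a''b' - a'b''`, this integrand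
equals `∂_1 P + ∂̄_2 Q / z_2`, where `P = -(∂_1ρ) S W` and `Q = (ρ ∂_1²ρ - (∂_1ρ)²/2) W + (ρ²/2) V`.
The first term integrates to zero. The Cauchy–Pompeiu formula in `z_2` (`integral_dbar_div`,
`integral_dzbar_div`) turns the second into `-π` times the integral of `Q` over `z_2 = 0`, where `ρ
= 1` locally and hence `Q = V/2`. As `ψ_2d` is `1/π` times the integral of `V`, the factor `-1/2`
results; it comes from `ρ ∂̄ρ = ∂̄(ρ²/2)`. This is `integral_transgression`.

For `ψ^1` the surviving derivative is `∂_2`. If `ρ` is independent of `z_1`, then `∂_1` falls only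
on `a` and `b`, and the two orders of the arguments give the same integral with opposite signs.

The relation between the constants needs `ψ_2d ≠ 0` (`exists_psi2d_ne_zero`): for `b` the complex
conjugate of `a'''`, integration by parts gives `-2/π` times the integral of `|a'''|²`. -/

noncomputable section

namespace HigherVir

/-! ### Forms with a single coefficient -/

/-- The form `f e_I`. -/
def mono {d : ℕ} (I : Finset (Gen d)) (f : (Fin d → ℂ) → ℂ) : Form d :=
  fun J => if J = I then f else 0

lemma fn_eq_mono {d : ℕ} (f : (Fin d → ℂ) → ℂ) : fn f = mono ∅ f := rfl

lemma gen_eq_mono {d : ℕ} (g : Gen d) : gen g = mono {g} 1 := rfl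

lemma mono_self {d : ℕ} (I : Finset (Gen d)) (f : (Fin d → ℂ) → ℂ) : mono I f I = f :=
  if_pos rfl

lemma neg_mono {d : ℕ} (I : Finset (Gen d)) (f : (Fin d → ℂ) → ℂ) :
    -mono I f = mono I (-f) := by
  funext J
  by_cases h : J = I <;> simp [mono, h]

@[simp] lemma wedge_zero {d : ℕ} (σ : Form d) : wedge σ 0 = 0 := by
  funext K z
  simp [wedge]

@[simp] lemma zero_wedge {d : ℕ} (σ : Form d) : wedge 0 σ = 0 := by
  funext K z
  simp [wedge]

lemma wedge_add {d : ℕ} (σ η τ : Form d) : wedge σ (η + τ) = wedge σ η + wedge σ τ := by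
  funext K z
  simp [wedge, mul_add, Finset.sum_add_distrib]

lemma add_wedge {d : ℕ} (σ η τ : Form d) : wedge (σ + η) τ = wedge σ τ + wedge η τ := by
  funext K z
  simp [wedge, mul_add, add_mul, Finset.sum_add_distrib]

lemma wedge_mono_apply {d : ℕ} (I J K : Finset (Gen d)) (f g : (Fin d → ℂ) → ℂ)
    (z : Fin d → ℂ) :
    wedge (mono I f) (mono J g) K z =
      if I ⊆ K ∧ K \ I = J then (wedgeSign I J : ℂ) * (f z * g z) else 0 := by
  unfold wedge
  split_ifs with h
  · obtain ⟨h, rfl⟩ := h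
    rw [Finset.sum_eq_single I]
    · simp [mono]
    · intro I' _ hI'
      simp [mono, hI']
    · simp [h]
  · refine Finset.sum_eq_zero fun I' hI' => ?_
    rw [Finset.mem_powerset] at hI'
    by_cases h1 : I' = I
    · subst h1
      have : K \ I' ≠ J := fun h2 => h ⟨hI', h2⟩
      simp [mono, this]
    · simp [mono, h1]

lemma wedge_mono_of_disjoint {d : ℕ} {I J : Finset (Gen d)} (h : Disjoint I J)
    (f g : (Fin d → ℂ) → ℂ) :
    wedge (mono I f) (mono J g) = mono (I ∪ J) fun z => wedgeSign I J * (f z * g z) := by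
  funext K z
  rw [wedge_mono_apply]
  by_cases hK : K = I ∪ J
  · subst hK
    simp [mono, Finset.union_sdiff_cancel_left h]
  · rw [if_neg, mono, if_neg hK]
    · rfl
    · rintro ⟨hI, rfl⟩
      exact hK (Finset.union_sdiff_of_subset hI).symm

lemma wedge_mono_of_not_disjoint {d : ℕ} {I J : Finset (Gen d)} (h : ¬Disjoint I J)
    (f g : (Fin d → ℂ) → ℂ) : wedge (mono I f) (mono J g) = 0 := by
  funext K z
  rw [wedge_mono_apply, if_neg]
  · rfl
  · rintro ⟨-, rfl⟩
    exact h Finset.disjoint_sdiff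

lemma lieDz_mono {d : ℕ} (k : Fin d) (I : Finset (Gen d)) (f : (Fin d → ℂ) → ℂ) :
    lieDz k (mono I f) = mono I (dz k f) := by
  funext J
  by_cases h : J = I <;> simp [lieDz, mono, h, dz_zero]

lemma lieDzbar_mono {d : ℕ} (k : Fin d) (I : Finset (Gen d)) (f : (Fin d → ℂ) → ℂ) :
    lieDzbar k (mono I f) = mono I (dzbar k f) := by
  funext J
  by_cases h : J = I <;> simp [lieDzbar, mono, h, dzbar_zero]

@[simp] lemma lieDz_zero {d : ℕ} (k : Fin d) : lieDz k (0 : Form d) = 0 := by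
  funext I
  exact dz_zero k

@[simp] lemma del_zero {d : ℕ} : del (0 : Form d) = 0 := by
  simp [del]

@[simp] lemma integral_zero {d : ℕ} : integral (0 : Form d) = 0 := by
  simp [integral]

lemma integral_mono {d : ℕ} (I : Finset (Gen d)) (f : (Fin d → ℂ) → ℂ) :
    integral (mono I f) = if Finset.univ = I then (-2 * Complex.I) ^ d * ∫ z, f z else 0 := by
  unfold integral mono
  split_ifs <;> simp

/-! ### Forms which do not contain a given generator -/

/-- The form has no terms which contain the generator `g`. -/
def Lacks {d : ℕ} (g : Gen d) (σ : Form d) : Prop := ∀ I, g ∈ I → σ I = 0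

lemma Lacks.wedge {d : ℕ} {g : Gen d} {σ η : Form d} (h : Lacks g σ) (h' : Lacks g η) :
    Lacks g (wedge σ η) := by
  intro K hK
  funext z
  refine Finset.sum_eq_zero fun I _ => ?_
  by_cases hI : g ∈ I
  · simp [h I hI]
  · simp [h' (K \ I) (Finset.mem_sdiff.2 ⟨hK, hI⟩)]

lemma Lacks.lieDz {d : ℕ} {g : Gen d} {σ : Form d} (h : Lacks g σ) (k : Fin d) :
    Lacks g (lieDz k σ) := by
  intro I hI
  simp [HigherVir.lieDz, h I hI, dz_zero]

lemma lacks_mono {d : ℕ} {g : Gen d} {I : Finset (Gen d)} (h : g ∉ I) (f : (Fin d → ℂ) → ℂ) :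
    Lacks g (mono I f) := by
  intro J hJ
  refine if_neg ?_
  rintro rfl
  exact h hJ

lemma Lacks.sum {d : ℕ} {g : Gen d} {ι : Type*} {s : Finset ι} {σ : ι → Form d}
    (h : ∀ i ∈ s, Lacks g (σ i)) : Lacks g (∑ i ∈ s, σ i) := by
  intro I hI
  rw [Finset.sum_apply]
  exact Finset.sum_eq_zero fun i hi => h i hi I hI

/-- Only a `dz̄` can be excluded here, because `∂` introduces the generators `dz_j` and no others.
-/
lemma Lacks.del {d : ℕ} {k : Fin d} {σ : Form d} (h : Lacks (k, true) σ) :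
    Lacks (k, true) (del σ) :=
  Lacks.sum fun j _ => (lacks_mono (by simp) _).wedge (h.lieDz j)

lemma Lacks.smul {d : ℕ} {g : Gen d} {σ : Form d} (h : Lacks g σ) (c : ℂ) : Lacks g (c • σ) := by
  intro I hI
  simp [h I hI]

lemma lacks_zero {d : ℕ} (g : Gen d) : Lacks g (0 : Form d) := fun _ _ => rfl

/-- The top degree basis form contains every generator. -/
lemma Lacks.integral_eq_zero {d : ℕ} {g : Gen d} {σ : Form d} (h : Lacks g σ) :
    integral σ = 0 := by
  simp [integral, h Finset.univ (Finset.mem_univ g)]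

lemma lacks_pull (α : Form 1) : Lacks (1, true) (pull α) := by
  intro K hK
  funext z
  refine Finset.sum_eq_zero fun I _ => if_neg ?_
  rintro rfl
  simp at hK

/-! ### Dolbeault forms on `ℂ` -/

lemma eq_zero_of_mem_dolb_one {q : ℤ} {σ : Form 1} (h : σ ∈ Dolb 1 q) (h0 : q ≠ 0) (h1 : q ≠ 1) :
    σ = 0 := by
  funext I
  by_contra hI
  obtain ⟨hg, hc⟩ := h.2.2 I hI
  have : I ⊆ {(0, true)} := fun g hgI => by
    have := hg g hgI
    rw [Finset.mem_singleton]
    exact Prod.ext (Subsingleton.elim _ _) this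
  rcases Finset.subset_singleton_iff.1 this with rfl | rfl
  · exact h0 (by simpa using hc.symm)
  · exact h1 (by simpa using hc.symm)

lemma eq_mono_of_mem_dolb_zero {d : ℕ} {σ : Form d} (h : σ ∈ Dolb d 0) : σ = mono ∅ (σ ∅) := by
  funext I
  by_cases hI : I = ∅
  · simp [hI, mono]
  · rw [mono, if_neg hI]
    by_contra h'
    exact hI (by simpa using (h.2.2 I h').2)

lemma eq_mono_of_mem_dolb_one {σ : Form 1} (h : σ ∈ Dolb 1 1) :
    σ = mono {(0, true)} (σ {(0, true)}) := by
  funext I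
  by_cases hI : I = {(0, true)}
  · simp [hI, mono]
  · rw [mono, if_neg hI]
    by_contra h'
    obtain ⟨hg, hc⟩ := h.2.2 I h'
    refine hI (Finset.eq_of_subset_of_card_le (fun g hgI => ?_) ?_)
    · rw [Finset.mem_singleton]
      exact Prod.ext (Subsingleton.elim _ _) (hg g hgI)
    · have : I.card = 1 := by exact_mod_cast hc
      simp [this]

lemma pull_zero : pull 0 = 0 := by
  funext K z
  simp [pull]

lemma pull_mono (I : Finset (Gen 1)) (f : (Fin 1 → ℂ) → ℂ) :
    pull (mono I f) = mono (I.image fun g => ((0 : Fin 2), g.2)) fun z => f fun _ => z 0 := by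
  have hinj : Function.Injective fun g : Gen 1 => ((0 : Fin 2), g.2) := by
    rintro ⟨a, b⟩ ⟨a', b'⟩ hab
    simp only [Prod.mk.injEq, true_and] at hab
    exact Prod.ext (Subsingleton.elim _ _) hab
  funext K z
  unfold pull
  rw [Finset.sum_eq_single I]
  · by_cases h : K = I.image fun g => ((0 : Fin 2), g.2) <;> simp [mono, h]
  · intro J _ hJ
    simp [mono, hJ]
  · simp

/-! ### The Cauchy–Pompeiu formula -/

/-- The boundary integral of `c / z` over the square of half-side `R`. A quarter turn maps the
vertical sides to the horizontal ones and preserves `dz / z`, so the four sides merge into one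
arctangent integral. -/
lemma integral_rect_inv {R : ℝ} (hR : 0 < R) (c : ℂ) :
    (∫ x : ℝ in -R..R, c / (x + (-R : ℝ) * Complex.I)) -
        (∫ x : ℝ in -R..R, c / (x + (R : ℝ) * Complex.I)) +
        Complex.I • (∫ y : ℝ in -R..R, c / ((R : ℝ) + y * Complex.I)) -
        Complex.I • (∫ y : ℝ in -R..R, c / ((-R : ℝ) + y * Complex.I)) =
      2 * Real.pi * Complex.I * c := by
  have hne : ∀ x y : ℝ, x ≠ 0 ∨ y ≠ 0 → (x + y * Complex.I : ℂ) ≠ 0 := by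
    intro x y hxy h
    have h1 := congrArg Complex.re h
    have h2 := congrArg Complex.im h
    simp at h1 h2
    tauto
  have h1 : ∀ s : ℝ, s ≠ 0 → IntervalIntegrable (fun x : ℝ => c / (x + s * Complex.I))
      MeasureTheory.volume (-R) R := fun s hs =>
    Continuous.intervalIntegrable
      (continuous_const.div (by fun_prop) fun x => hne x s (Or.inr hs)) _ _
  have h2 : ∀ s : ℝ, s ≠ 0 → IntervalIntegrable (fun y : ℝ => c / (s + y * Complex.I))
      MeasureTheory.volume (-R) R := fun s hs =>
    Continuous.intervalIntegrable
      (continuous_const.div (by fun_prop) fun x => hne s x (Or.inl hs)) _ _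
  have h3 : ∀ s : ℝ, s ≠ 0 → IntervalIntegrable
      (fun y : ℝ => Complex.I • (c / (s + y * Complex.I))) MeasureTheory.volume (-R) R :=
    fun s hs => (h2 s hs).smul Complex.I
  have hR' : R ≠ 0 := hR.ne'
  have hnR : -R ≠ 0 := neg_ne_zero.2 hR'
  rw [← intervalIntegral.integral_smul, ← intervalIntegral.integral_smul,
    ← intervalIntegral.integral_sub (h1 _ hnR) (h1 _ hR'),
    ← intervalIntegral.integral_add ((h1 _ hnR).sub (h1 _ hR')) (h3 _ hR'),
    ← intervalIntegral.integral_sub (((h1 _ hnR).sub (h1 _ hR')).add (h3 _ hR'))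
      (h3 _ hnR)]
  -- With `v = x - iR` and `u = x + iR`, the vertical sides have denominators `iv` and `iu`. The sum
  -- is therefore `2c (1/v - 1/u)`, where `u - v = 2iR` and `uv = x² + R²`.
  have key : ∀ x : ℝ, c / (x + (-R : ℝ) * Complex.I) - c / (x + (R : ℝ) * Complex.I) +
      Complex.I • (c / ((R : ℝ) + x * Complex.I)) -
      Complex.I • (c / ((-R : ℝ) + x * Complex.I)) =
      (4 * Complex.I * c) * ((R / (R ^ 2 + x ^ 2) : ℝ) : ℂ) := by
    intro x
    have e1 := hne x (-R) (Or.inr hnR)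
    have e2 := hne x R (Or.inr hR')
    have f1 : (R : ℂ) + x * Complex.I = Complex.I * (x + (-R : ℝ) * Complex.I) := by
      push_cast; linear_combination (R : ℂ) * Complex.I_sq
    have f2 : ((-R : ℝ) : ℂ) + x * Complex.I = Complex.I * (x + R * Complex.I) := by
      push_cast; linear_combination -(R : ℂ) * Complex.I_sq
    have f5 : ((R ^ 2 + x ^ 2 : ℝ) : ℂ) = (x + (-R : ℝ) * Complex.I) * (x + R * Complex.I) := by
      push_cast; linear_combination (R : ℂ) ^ 2 * Complex.I_sq
    rw [f1, f2, Complex.ofReal_div, f5, smul_eq_mul, smul_eq_mul]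
    have f6 : (2 * Complex.I * R : ℂ) =
        (x + R * Complex.I) - (x + (-R : ℝ) * Complex.I) := by
      push_cast; ring
    have f7 : 4 * Complex.I * c * (R / ((x + (-R : ℝ) * Complex.I) * (x + R * Complex.I))) =
        2 * c * ((2 * Complex.I * R) / ((x + (-R : ℝ) * Complex.I) * (x + R * Complex.I))) := by
      ring
    rw [f7, f6]
    generalize (x + (-R : ℝ) * Complex.I : ℂ) = v at *
    generalize (x + R * Complex.I : ℂ) = u at *
    have hI := Complex.I_ne_zero
    field_simp
    ring
  simp only [key]
  rw [intervalIntegral.integral_const_mul, intervalIntegral.integral_ofReal,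
    integral_div_sq_add_sq]
  simp only [neg_div, div_self hR', Real.arctan_neg, Real.arctan_one]
  push_cast
  ring

lemma contDiff_div_of_eventuallyEq_zero {E : Type*} [NormedAddCommGroup E] [NormedSpace ℝ E]
    {g ℓ : E → ℂ} (hg : ContDiff ℝ ∞ g) (hℓ : ContDiff ℝ ∞ ℓ)
    (h0 : ∀ z, ℓ z = 0 → g =ᶠ[nhds z] 0) : ContDiff ℝ ∞ fun z => g z / ℓ z := by
  refine contDiff_iff_contDiffAt.2 fun z => ?_
  by_cases hz : ℓ z = 0
  · refine (contDiffAt_const (c := (0 : ℂ))).congr_of_eventuallyEq ?_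
    filter_upwards [h0 z hz] with w hw
    simp [hw]
  · simp only [div_eq_mul_inv]
    exact hg.contDiffAt.mul (hℓ.contDiffAt.inv hz)

lemma integral_eq_integral_rect {D : ℂ → ℂ} (hD : Continuous D) {R : ℝ} (hR : 0 < R)
    (hs : ∀ z, D z ≠ 0 → ‖z‖ < R) :
    ∫ z, D z = ∫ x : ℝ in -R..R, ∫ y : ℝ in -R..R, D (x + y * Complex.I) := by
  have hle : -R ≤ R := by linarith
  rw [← Complex.volume_preserving_equiv_real_prod.symm.integral_comp
    Complex.measurableEquivRealProd.symm.measurableEmbedding]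
  rw [← MeasureTheory.setIntegral_eq_integral_of_forall_compl_eq_zero
    (s := Set.Ioc (-R) R ×ˢ Set.Ioc (-R) R)]
  · rw [MeasureTheory.Measure.volume_eq_prod, MeasureTheory.setIntegral_prod]
    · rw [intervalIntegral.integral_of_le hle]
      congr 1
      funext x
      rw [intervalIntegral.integral_of_le hle]
      congr 1
      funext y
      simp [Complex.mk_eq_add_mul_I]
    · refine MeasureTheory.IntegrableOn.mono_set (t := Set.Icc (-R) R ×ˢ Set.Icc (-R) R) ?_ ?_
      · refine ContinuousOn.integrableOn_compact (isCompact_Icc.prod isCompact_Icc) ?_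
        refine Continuous.continuousOn (hD.comp ?_)
        exact Complex.equivRealProdCLM.symm.continuous
      · exact Set.prod_mono Set.Ioc_subset_Icc_self Set.Ioc_subset_Icc_self
  · rintro ⟨x, y⟩ hxy
    by_contra hne
    have h := hs _ hne
    have h1 := (Complex.abs_re_le_norm _).trans_lt h
    have h2 := (Complex.abs_im_le_norm _).trans_lt h
    simp [Complex.measurableEquivRealProd_symm_apply] at h1 h2
    rw [abs_lt] at h1 h2
    exact hxy ⟨⟨h1.1, h1.2.le⟩, ⟨h2.1, h2.2.le⟩⟩

/-- `∂g/∂z̄`, for a function of one complex variable. -/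
def dbar (g : ℂ → ℂ) (z : ℂ) : ℂ :=
  (1 / 2) * (fderiv ℝ g z 1 + Complex.I * fderiv ℝ g z Complex.I)

/-- The Cauchy–Pompeiu formula at the origin, for a function which is constant near the origin. -/
theorem integral_dbar_div {g : ℂ → ℂ} (hg : ContDiff ℝ ∞ g) (hc : HasCompactSupport g)
    (h0 : ∀ᶠ z in nhds 0, g z = g 0) : ∫ z, dbar g z / z = -Real.pi * g 0 := by
  -- Subtracting `g 0` removes the pole, so Stokes applies on the whole square without excising a
  -- disc. On the boundary `g = 0`, and the quotient becomes `-g 0 / z`.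
  have hf : ContDiff ℝ ∞ fun z : ℂ => (g z - g 0) / z := by
    refine contDiff_div_of_eventuallyEq_zero (hg.sub contDiff_const) contDiff_id fun z hz => ?_
    obtain rfl : z = 0 := hz
    filter_upwards [h0] with w hw
    simp [hw]
  have hdg : ContDiff ℝ ∞ (dbar g) := by
    have h : ContDiff ℝ ∞ (fderiv ℝ g) := hg.fderiv_right le_rfl
    exact contDiff_const.mul ((h.clm_apply contDiff_const).add
      (contDiff_const.mul (h.clm_apply contDiff_const)))
  have hD : ContDiff ℝ ∞ fun z : ℂ => dbar g z / z := by
    refine contDiff_div_of_eventuallyEq_zero hdg contDiff_id fun z hz => ?_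
    obtain rfl : z = 0 := hz
    filter_upwards [h0.eventually_nhds] with w hw
    have : fderiv ℝ g w = 0 := by
      have he : g =ᶠ[nhds w] fun _ => g 0 := hw
      rw [he.fderiv_eq]
      simp
    simp [dbar, this]
  obtain ⟨R, hR, hsupp⟩ : ∃ R : ℝ, 0 < R ∧ ∀ z, z ∈ tsupport g → ‖z‖ < R := by
    obtain ⟨R, hR⟩ := (show IsCompact (tsupport g) from hc).isBounded.exists_norm_le
    exact ⟨max R 0 + 1, by positivity, fun z hz => by
      have := hR z hz
      have := le_max_left R 0
      linarith⟩
  have hg0 : ∀ z, R ≤ ‖z‖ → g z = 0 := fun z hz =>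
    image_eq_zero_of_notMem_tsupport fun h => absurd (hsupp z h) (not_lt.2 hz)
  have hrect := Complex.integral_boundary_rect_of_differentiableOn_real
    (fun z : ℂ => (g z - g 0) / z) (-R + -R * Complex.I) (R + R * Complex.I)
    (hf.differentiable (by simp)).differentiableOn (by
      refine ContinuousOn.integrableOn_compact ?_ ?_
      · exact isCompact_uIcc.reProdIm isCompact_uIcc
      · have h : Continuous (fderiv ℝ fun z : ℂ => (g z - g 0) / z) :=
          hf.continuous_fderiv (by simp)
        fun_prop)
  -- The integrand in Stokes' formula is `2i ∂̄` of the quotient, and `1/z` is holomorphic away from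
  -- `0`. At `0` both sides vanish, the right one by the convention `x / 0 = 0`.
  have hderiv : ∀ z : ℂ, Complex.I • fderiv ℝ (fun z : ℂ => (g z - g 0) / z) z 1 -
      fderiv ℝ (fun z : ℂ => (g z - g 0) / z) z Complex.I = 2 * Complex.I * (dbar g z / z) := by
    intro z
    by_cases hz : z = 0
    · subst hz
      have he : (fun z : ℂ => (g z - g 0) / z) =ᶠ[nhds 0] fun _ => 0 := by
        filter_upwards [h0] with w hw
        simp [hw]
      rw [he.fderiv_eq]
      simp
    · have hgz : DifferentiableAt ℝ g z := hg.differentiable (by simp) z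
      have hinv := (hasDerivAt_inv hz).hasFDerivAt.restrictScalars ℝ
      have h := (hgz.hasFDerivAt.sub_const (g 0)).mul hinv
      have he : fderiv ℝ (fun z : ℂ => (g z - g 0) / z) z = _ := h.fderiv
      rw [he]
      simp [dbar]
      field_simp
      linear_combination (-(z * fderiv ℝ g z Complex.I)) * Complex.I_sq
  simp only [hderiv] at hrect
  have hb : ∀ z : ℂ, R ≤ ‖z‖ → (g z - g 0) / z = (-g 0) / z := fun z hz => by
    rw [hg0 z hz, zero_sub]
  have hre : ∀ x y : ℝ, R ≤ |x| ∨ R ≤ |y| → R ≤ ‖(x + y * Complex.I : ℂ)‖ := by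
    rintro x y (h | h)
    · exact h.trans (by simpa using Complex.abs_re_le_norm (x + y * Complex.I : ℂ))
    · exact h.trans (by simpa using Complex.abs_im_le_norm (x + y * Complex.I : ℂ))
  have hRR : R ≤ |R| := le_abs_self R
  have hRR' : R ≤ |-R| := by rw [abs_neg]; exact hRR
  have hbound := integral_rect_inv hR (-g 0)
  simp only [← hb _ (hre _ _ (Or.inl hRR)), ← hb _ (hre _ _ (Or.inl hRR')),
    ← hb _ (hre _ _ (Or.inr hRR)), ← hb _ (hre _ _ (Or.inr hRR'))] at hbound
  have hint := integral_eq_integral_rect hD.continuous hR fun z hz => hsupp z (by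
    by_contra h
    apply hz
    simp [dbar, fderiv_of_notMem_tsupport ℝ h])
  simp at hrect hbound
  rw [hbound] at hrect
  rw [hint]
  have hI : (2 * Complex.I : ℂ) ≠ 0 := by simp
  apply mul_left_cancel₀ hI
  rw [← hrect]
  ring

/-! ### Wirtinger derivatives -/

section Algebra

variable {E : Type*} [NormedAddCommGroup E] [NormedSpace ℝ E] {f g : E → ℂ}

/-- Smoothness for operations in the ring of functions, the shape in which `dz_mul` and `dz_add`
rewrite. -/
lemma _root_.ContDiff.pi_mul (hf : ContDiff ℝ ∞ f) (hg : ContDiff ℝ ∞ g) : ContDiff ℝ ∞ (f * g) :=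
  hf.mul hg

lemma _root_.ContDiff.pi_add (hf : ContDiff ℝ ∞ f) (hg : ContDiff ℝ ∞ g) : ContDiff ℝ ∞ (f + g) :=
  hf.add hg

lemma _root_.ContDiff.pi_neg (hf : ContDiff ℝ ∞ f) : ContDiff ℝ ∞ (-f) :=
  hf.neg

end Algebra

section Wirtinger

variable {d : ℕ} (k : Fin d) {f g : (Fin d → ℂ) → ℂ}

lemma dz_congr {z : Fin d → ℂ} (h : f =ᶠ[nhds z] g) : dz k f z = dz k g z := by
  simp [dz, h.fderiv_eq]

lemma dzbar_congr {z : Fin d → ℂ} (h : f =ᶠ[nhds z] g) : dzbar k f z = dzbar k g z := by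
  simp [dzbar, h.fderiv_eq]

lemma dz_const (c : ℂ) : dz k (fun _ => c) = 0 := by
  funext z
  simp [dz]

lemma dzbar_const (c : ℂ) : dzbar k (fun _ => c) = 0 := by
  funext z
  simp [dzbar]

lemma dz_neg : dz k (-f) = -dz k f := by
  funext z
  simp only [dz, fderiv_neg, Pi.neg_apply, neg_apply]
  ring

lemma dz_add (hf : ContDiff ℝ ∞ f) (hg : ContDiff ℝ ∞ g) : dz k (f + g) = dz k f + dz k g := by
  funext z
  simp only [dz, fderiv_add (hf.differentiable (by simp) z) (hg.differentiable (by simp) z),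
    Pi.add_apply, add_apply]
  ring

lemma dzbar_add (hf : ContDiff ℝ ∞ f) (hg : ContDiff ℝ ∞ g) :
    dzbar k (f + g) = dzbar k f + dzbar k g := by
  funext z
  simp only [dzbar, fderiv_add (hf.differentiable (by simp) z) (hg.differentiable (by simp) z),
    Pi.add_apply, add_apply]
  ring

lemma dz_mul (hf : ContDiff ℝ ∞ f) (hg : ContDiff ℝ ∞ g) :
    dz k (f * g) = dz k f * g + f * dz k g := by
  funext z
  simp only [dz, fderiv_mul (hf.differentiable (by simp) z) (hg.differentiable (by simp) z),
    Pi.add_apply, Pi.mul_apply, add_apply, smul_apply,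
    smul_eq_mul]
  ring

lemma dzbar_mul (hf : ContDiff ℝ ∞ f) (hg : ContDiff ℝ ∞ g) :
    dzbar k (f * g) = dzbar k f * g + f * dzbar k g := by
  funext z
  simp only [dzbar, fderiv_mul (hf.differentiable (by simp) z) (hg.differentiable (by simp) z),
    Pi.add_apply, Pi.mul_apply, add_apply, smul_apply,
    smul_eq_mul]
  ring

lemma fderiv_dz (hf : ContDiff ℝ ∞ f) (z v : Fin d → ℂ) :
    fderiv ℝ (dz k f) z v = (1 / 2) * (fderiv ℝ (fderiv ℝ f) z v (Pi.single k 1) -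
      Complex.I * fderiv ℝ (fderiv ℝ f) z v (Pi.single k Complex.I)) := by
  have h : ContDiff ℝ ∞ (fderiv ℝ f) := hf.fderiv_right le_rfl
  have h' : HasFDerivAt (fderiv ℝ f) _ z := (h.differentiable (by simp) z).hasFDerivAt
  have h1 := h'.clm_apply (hasFDerivAt_const (Pi.single k (1 : ℂ)) z)
  have h2 := h'.clm_apply (hasFDerivAt_const (Pi.single k Complex.I) z)
  have h3 := ((h1.sub (h2.const_mul Complex.I)).const_mul (1 / 2)).fderiv
  change fderiv ℝ (dz k f) z = _ at h3
  simp [h3]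

lemma fderiv_dzbar (hf : ContDiff ℝ ∞ f) (z v : Fin d → ℂ) :
    fderiv ℝ (dzbar k f) z v = (1 / 2) * (fderiv ℝ (fderiv ℝ f) z v (Pi.single k 1) +
      Complex.I * fderiv ℝ (fderiv ℝ f) z v (Pi.single k Complex.I)) := by
  have h : ContDiff ℝ ∞ (fderiv ℝ f) := hf.fderiv_right le_rfl
  have h' : HasFDerivAt (fderiv ℝ f) _ z := (h.differentiable (by simp) z).hasFDerivAt
  have h1 := h'.clm_apply (hasFDerivAt_const (Pi.single k (1 : ℂ)) z)
  have h2 := h'.clm_apply (hasFDerivAt_const (Pi.single k Complex.I) z)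
  have h3 := ((h1.add (h2.const_mul Complex.I)).const_mul (1 / 2)).fderiv
  change fderiv ℝ (dzbar k f) z = _ at h3
  simp [h3, mul_add]

lemma dz_dzbar_comm (j : Fin d) (hf : ContDiff ℝ ∞ f) :
    dz k (dzbar j f) = dzbar j (dz k f) := by
  funext z
  have hs : IsSymmSndFDerivAt ℝ f z :=
    hf.contDiffAt.isSymmSndFDerivAt (by
      rw [minSmoothness_of_isRCLikeNormedField]
      exact WithTop.coe_le_coe.2 (le_top (a := (2 : ℕ∞))))
  rw [dz, dzbar, fderiv_dz k hf, fderiv_dz k hf, fderiv_dzbar j hf, fderiv_dzbar j hf,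
    hs (Pi.single k 1) (Pi.single j 1), hs (Pi.single k 1) (Pi.single j Complex.I),
    hs (Pi.single k Complex.I) (Pi.single j 1),
    hs (Pi.single k Complex.I) (Pi.single j Complex.I)]
  ring

/-- Integration by parts against the constant function `1`. -/
lemma integral_fderiv_eq_zero (hf : ContDiff ℝ ∞ f) (hc : HasCompactSupport f)
    (v : Fin d → ℂ) : ∫ z, fderiv ℝ f z v = 0 := by
  have h1 : Continuous (fderiv ℝ f) := hf.continuous_fderiv (by simp)
  have h2 : HasCompactSupport fun z => fderiv ℝ f z v := hc.fderiv_apply (𝕜 := ℝ) v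
  have := integral_mul_fderiv_eq_neg_fderiv_mul_of_integrable (μ := MeasureTheory.volume)
    (f := fun _ : Fin d → ℂ => (1 : ℂ)) (g := f) (v := v) (by simp)
    (by simpa using (h1.clm_apply continuous_const).integrable_of_hasCompactSupport h2)
    (by simpa using hf.continuous.integrable_of_hasCompactSupport hc)
    (fun _ _ => differentiableAt_const _) (fun z _ => hf.differentiable (by simp) z)
  simpa using this

lemma integral_dz_eq_zero (hf : ContDiff ℝ ∞ f) (hc : HasCompactSupport f) :
    ∫ z, dz k f z = 0 := by
  have h1 : Continuous (fderiv ℝ f) := hf.continuous_fderiv (by simp)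
  have h2 : ∀ v, MeasureTheory.Integrable fun z => fderiv ℝ f z v := fun v =>
    (h1.clm_apply continuous_const).integrable_of_hasCompactSupport (hc.fderiv_apply (𝕜 := ℝ) v)
  unfold dz
  rw [MeasureTheory.integral_const_mul, MeasureTheory.integral_sub (h2 _) ((h2 _).const_mul _),
    MeasureTheory.integral_const_mul, integral_fderiv_eq_zero hf hc,
    integral_fderiv_eq_zero hf hc]
  simp

end Wirtinger

/-! ### Functions pulled back from the first coordinate -/

/-- The pullback of a function along `(z_1, z_2) ↦ z_1`. -/
def pullFn (a : (Fin 1 → ℂ) → ℂ) : (Fin 2 → ℂ) → ℂ := fun z => a fun _ => z 0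

lemma contDiff_pullFn {a : (Fin 1 → ℂ) → ℂ} (ha : ContDiff ℝ ∞ a) : ContDiff ℝ ∞ (pullFn a) :=
  ha.comp (contDiff_pi.2 fun _ => contDiff_apply ℝ ℂ (0 : Fin 2))

lemma fderiv_pullFn {a : (Fin 1 → ℂ) → ℂ} (ha : ContDiff ℝ ∞ a) (z v : Fin 2 → ℂ) :
    fderiv ℝ (pullFn a) z v = fderiv ℝ a (fun _ => z 0) fun _ => v 0 := by
  have h1 : HasFDerivAt (fun z : Fin 2 → ℂ => fun _ : Fin 1 => z 0)
      (ContinuousLinearMap.pi fun _ : Fin 1 =>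
        ContinuousLinearMap.proj (R := ℝ) (φ := fun _ : Fin 2 => ℂ) 0) z :=
    (ContinuousLinearMap.pi fun _ : Fin 1 =>
      ContinuousLinearMap.proj (R := ℝ) (φ := fun _ : Fin 2 => ℂ) 0).hasFDerivAt
  have h2 : HasFDerivAt (pullFn a) _ z :=
    (ha.differentiable (by simp) (fun _ : Fin 1 => z 0)).hasFDerivAt.comp z h1
  rw [h2.fderiv]
  rfl

lemma const_eq_single (c : ℂ) : (fun _ : Fin 1 => c) = Pi.single 0 c := by
  funext i
  fin_cases i
  simp

lemma dz_zero_pullFn {a : (Fin 1 → ℂ) → ℂ} (ha : ContDiff ℝ ∞ a) :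
    dz 0 (pullFn a) = pullFn (dz 0 a) := by
  funext z
  simp [dz, pullFn.eq_def (dz 0 a), fderiv_pullFn ha, const_eq_single]

lemma dz_one_pullFn {a : (Fin 1 → ℂ) → ℂ} (ha : ContDiff ℝ ∞ a) : dz 1 (pullFn a) = 0 := by
  funext z
  have : (fun _ : Fin 1 => (0 : ℂ)) = 0 := rfl
  simp [dz, fderiv_pullFn ha, this]

lemma dzbar_one_pullFn {a : (Fin 1 → ℂ) → ℂ} (ha : ContDiff ℝ ∞ a) :
    dzbar 1 (pullFn a) = 0 := by
  funext z
  have : (fun _ : Fin 1 => (0 : ℂ)) = 0 := rfl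
  simp [dzbar, fderiv_pullFn ha, this]

/-! ### Functions which vanish near `z_2 = 0` -/

/-- The function vanishes near `z_2 = 0`. -/
def VanishesNear (u : (Fin 2 → ℂ) → ℂ) : Prop := ∀ z : Fin 2 → ℂ, z 1 = 0 → u =ᶠ[nhds z] 0

lemma VanishesNear.contDiff_div {u : (Fin 2 → ℂ) → ℂ} (h : VanishesNear u)
    (hu : ContDiff ℝ ∞ u) : ContDiff ℝ ∞ fun z => u z / z 1 :=
  contDiff_div_of_eventuallyEq_zero hu (contDiff_apply ℝ ℂ (1 : Fin 2)) h

lemma vanishesNear_dz {f g : (Fin 2 → ℂ) → ℂ} (k : Fin 2) (hg : dz k g = 0)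
    (h : ∀ z : Fin 2 → ℂ, z 1 = 0 → f =ᶠ[nhds z] g) : VanishesNear (dz k f) := by
  intro z hz
  filter_upwards [(h z hz).eventually_nhds] with w hw
  rw [dz_congr k hw, hg]

lemma vanishesNear_dzbar {f g : (Fin 2 → ℂ) → ℂ} (k : Fin 2) (hg : dzbar k g = 0)
    (h : ∀ z : Fin 2 → ℂ, z 1 = 0 → f =ᶠ[nhds z] g) : VanishesNear (dzbar k f) := by
  intro z hz
  filter_upwards [(h z hz).eventually_nhds] with w hw
  rw [dzbar_congr k hw, hg]

lemma dz_coord : dz 0 (fun z : Fin 2 → ℂ => z 1) = 0 := by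
  funext z
  have h : fderiv ℝ (fun z : Fin 2 → ℂ => z 1) z =
      ContinuousLinearMap.proj (R := ℝ) (φ := fun _ : Fin 2 => ℂ) 1 :=
    (ContinuousLinearMap.proj (R := ℝ) (φ := fun _ : Fin 2 => ℂ) 1).fderiv
  simp [dz, h]

/-- Apply the Leibniz rule to `u = (u / z_2) z_2`, where `∂_1` kills `z_2`. This product formula
holds everywhere because `u` vanishes where the division has its default value. -/
lemma VanishesNear.dz_div {u : (Fin 2 → ℂ) → ℂ} (h : VanishesNear u) (hu : ContDiff ℝ ∞ u) :
    dz 0 (fun z => u z / z 1) = fun z => dz 0 u z / z 1 := by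
  funext z
  by_cases hz : z 1 = 0
  · have : (fun z => u z / z 1) =ᶠ[nhds z] 0 := by
      filter_upwards [h z hz] with w hw
      simp [hw]
    rw [dz_congr 0 this, dz_zero, hz]
    simp
  · have he : u = (fun z => u z / z 1) * fun z => z 1 := by
      funext w
      by_cases hw : w 1 = 0
      · simp [hw, (h w hw).eq_of_nhds]
      · simp [hw]
    have h1 := congrFun (congrArg (dz 0) he) z
    rw [dz_mul 0 (h.contDiff_div hu) (contDiff_apply ℝ ℂ (1 : Fin 2)), dz_coord] at h1
    rw [h1]
    simp [hz]

/-! ### Integration along the second coordinate -/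

lemma dzbar_one_eq_dbar {Q : (Fin 2 → ℂ) → ℂ} (hQ : ContDiff ℝ ∞ Q) (x y : ℂ) :
    dzbar 1 Q ![x, y] = dbar (fun y => Q ![x, y]) y := by
  have h1 : HasFDerivAt (fun y : ℂ => ![x, y])
      (ContinuousLinearMap.single ℝ (fun _ : Fin 2 => ℂ) 1) y := by
    have he : (fun y : ℂ => ![x, y]) = fun y => ![x, 0] +
        ContinuousLinearMap.single ℝ (fun _ : Fin 2 => ℂ) 1 y := by
      funext y i
      fin_cases i <;> simp
    rw [he]
    exact (ContinuousLinearMap.hasFDerivAt _).const_add _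
  have h2 := ((hQ.differentiable (by simp) ![x, y]).hasFDerivAt.comp y h1).fderiv
  change fderiv ℝ (fun y => Q ![x, y]) y = _ at h2
  simp [dzbar, dbar, h2]

lemma integral_fin_two {F : (Fin 2 → ℂ) → ℂ} (hF : Continuous F) (hc : HasCompactSupport F) :
    ∫ z, F z = ∫ x : ℂ, ∫ y : ℂ, F ![x, y] := by
  have hF' : MeasureTheory.Integrable F := hF.integrable_of_hasCompactSupport hc
  have hp := (MeasureTheory.volume_preserving_finTwoArrow ℂ).symm
  rw [← hp.integral_comp (MeasurableEquiv.finTwoArrow (α := ℂ)).symm.measurableEmbedding,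
    MeasureTheory.Measure.volume_eq_prod, MeasureTheory.integral_prod]
  · rfl
  · exact (hp.integrable_comp_emb
      (MeasurableEquiv.finTwoArrow (α := ℂ)).symm.measurableEmbedding).2 hF'

lemma integral_fin_one (F : (Fin 1 → ℂ) → ℂ) : ∫ z, F z = ∫ x : ℂ, F fun _ => x := by
  have hp := (MeasureTheory.volume_preserving_funUnique (Fin 1) ℂ).symm
  exact (hp.integral_comp (MeasurableEquiv.funUnique (Fin 1) ℂ).symm.measurableEmbedding F).symm

lemma hasCompactSupport_div {u : (Fin 2 → ℂ) → ℂ} (hu : HasCompactSupport u) :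
    HasCompactSupport fun z => u z / z 1 :=
  HasCompactSupport.intro hu fun z hz => by simp [image_eq_zero_of_notMem_tsupport hz]

lemma hasCompactSupport_dzbar {d : ℕ} (k : Fin d) {f : (Fin d → ℂ) → ℂ}
    (hf : HasCompactSupport f) : HasCompactSupport (dzbar k f) :=
  HasCompactSupport.intro hf fun _ hz => dzbar_eq_zero_of_notMem k hz

/-- Fubini, and Cauchy–Pompeiu on each fibre of `π`. Agreement with a pulled back function near `z_2
= 0` makes `Q` constant near the origin of every fibre. -/
theorem integral_dzbar_div {Q : (Fin 2 → ℂ) → ℂ} (hQ : ContDiff ℝ ∞ Q)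
    (hc : HasCompactSupport Q) {H : (Fin 1 → ℂ) → ℂ} (hH : ContDiff ℝ ∞ H)
    (h : ∀ z : Fin 2 → ℂ, z 1 = 0 → Q =ᶠ[nhds z] pullFn H) :
    ∫ z, dzbar 1 Q z / z 1 = -Real.pi * ∫ z, H z := by
  rw [integral_fin_two ((vanishesNear_dzbar 1 (dzbar_one_pullFn hH) h).contDiff_div
    (contDiff_dzbar 1 hQ)).continuous (hasCompactSupport_div (hasCompactSupport_dzbar 1 hc)),
    integral_fin_one, ← MeasureTheory.integral_const_mul]
  congr 1
  funext x
  have hcont : ContDiff ℝ ∞ fun y : ℂ => ![x, y] := by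
    refine contDiff_pi.2 fun i => ?_
    fin_cases i
    · exact contDiff_const
    · exact contDiff_id
  have hx : Q ![x, 0] = H fun _ => x := (h ![x, 0] (by simp)).eq_of_nhds
  rw [← hx]
  simp only [dzbar_one_eq_dbar hQ]
  refine integral_dbar_div (hQ.comp hcont) ?_ ?_
  · refine HasCompactSupport.intro
      ((show IsCompact (tsupport Q) from hc).image (continuous_apply 1)) fun y hy => ?_
    exact image_eq_zero_of_notMem_tsupport fun h' => hy ⟨_, h', by simp⟩
  · have ht : Filter.Tendsto (fun y : ℂ => ![x, y]) (nhds 0) (nhds ![x, 0]) :=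
      hcont.continuous.tendsto 0
    filter_upwards [ht.eventually (h ![x, 0] (by simp))] with y hy
    rw [hx, hy]
    rfl

/-! ### The four-dimensional integral reduced to `z_2 = 0` -/

namespace Bump

variable (ρ : Bump)

lemma eventuallyEq_one {z : Fin 2 → ℂ} (hz : z 1 = 0) : ρ.toFun =ᶠ[nhds z] fun _ => 1 := by
  obtain ⟨U₁, U₂, hU, -, hs, -, h1, -, -⟩ := ρ.exists_nhds
  filter_upwards [hU.mem_nhds (hs hz)] with w hw using h1 w hw

/-- The coefficient of `dz̄_2` in `∂̄ρ / z_2`. -/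
def ratio : (Fin 2 → ℂ) → ℂ := fun z => dzbar 1 ρ.toFun z / z 1

lemma vanishesNear_dzbar_toFun : VanishesNear (dzbar 1 ρ.toFun) :=
  vanishesNear_dzbar 1 (dzbar_const 1 1) fun _ hz => ρ.eventuallyEq_one hz

lemma vanishesNear_dz_toFun : VanishesNear (dz 0 ρ.toFun) :=
  vanishesNear_dz 0 (dz_const 0 1) fun _ hz => ρ.eventuallyEq_one hz

lemma contDiff_ratio : ContDiff ℝ ∞ ρ.ratio :=
  ρ.vanishesNear_dzbar_toFun.contDiff_div (contDiff_dzbar 1 ρ.smooth)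

lemma dz_ratio : dz 0 ρ.ratio = fun z => dzbar 1 (dz 0 ρ.toFun) z / z 1 := by
  unfold ratio
  rw [ρ.vanishesNear_dzbar_toFun.dz_div (contDiff_dzbar 1 ρ.smooth),
    dz_dzbar_comm 0 1 ρ.smooth]

lemma dz_dz_ratio : dz 0 (dz 0 ρ.ratio) = fun z => dzbar 1 (dz 0 (dz 0 ρ.toFun)) z / z 1 := by
  have h : VanishesNear (dzbar 1 (dz 0 ρ.toFun)) :=
    vanishesNear_dzbar 1 (dzbar_const 1 0) ρ.vanishesNear_dz_toFun
  have hs := contDiff_dz 0 ρ.smooth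
  rw [dz_ratio, h.dz_div (contDiff_dzbar 1 hs), dz_dzbar_comm 0 1 hs]

lemma hasCompactSupport_mul_pullFn {f : (Fin 2 → ℂ) → ℂ} {w : (Fin 1 → ℂ) → ℂ}
    (hf : ∀ z ∉ tsupport ρ.toFun, f z = 0) (hw : HasCompactSupport w) :
    HasCompactSupport (f * pullFn w) := by
  have hS : IsCompact ((fun x : Fin 1 → ℂ => x 0) '' tsupport w) :=
    (show IsCompact (tsupport w) from hw).image (continuous_apply 0)
  refine HasCompactSupport.intro (ρ.isCompact_tsupport hS) fun z hz => ?_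
  by_cases h : z ∈ tsupport ρ.toFun
  · have : pullFn w z = 0 :=
      image_eq_zero_of_notMem_tsupport (f := w) fun h' => hz ⟨h, fun _ => z 0, h', rfl⟩
    simp [this]
  · simp [hf z h]

variable {a b : (Fin 1 → ℂ) → ℂ}

theorem integral_transgression (ha : ContDiff ℝ ∞ a) (hb : ContDiff ℝ ∞ b)
    (hca : HasCompactSupport a) :
    ∫ z, (dz 0 (ρ.toFun * pullFn b) z * dz 0 (dz 0 (ρ.ratio * pullFn a)) z -
        dz 0 (ρ.toFun * pullFn a) z * dz 0 (dz 0 (ρ.ratio * pullFn b)) z) =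
      -(Real.pi / 2) *
        ∫ z, (dz 0 (dz 0 a) z * dz 0 b z - dz 0 a z * dz 0 (dz 0 b) z) := by
  have hR := ρ.smooth
  have hR1 := contDiff_dz 0 hR
  have hR2 := contDiff_dz 0 hR1
  have hS := ρ.contDiff_ratio
  have hS1 := contDiff_dz 0 hS
  have ha1 := contDiff_dz 0 ha
  have ha2 := contDiff_dz 0 ha1
  have hb1 := contDiff_dz 0 hb
  have hb2 := contDiff_dz 0 hb1
  have hA := contDiff_pullFn ha
  have hA1 := contDiff_pullFn ha1
  have hB := contDiff_pullFn hb
  have hB1 := contDiff_pullFn hb1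
  set W : (Fin 1 → ℂ) → ℂ := a * dz 0 b - dz 0 a * b with hW
  set V : (Fin 1 → ℂ) → ℂ := dz 0 (dz 0 a) * dz 0 b - dz 0 a * dz 0 (dz 0 b) with hV
  have hWs : ContDiff ℝ ∞ W := (ha.pi_mul hb1).sub (ha1.pi_mul hb)
  have hVs : ContDiff ℝ ∞ V := (ha2.pi_mul hb1).sub (ha1.pi_mul hb2)
  have hca1 := hasCompactSupport_dz 0 hca
  have hcW : HasCompactSupport W := (hca.mul_right (f' := dz 0 b)).sub (hca1.mul_right (f' := b))
  have hcV : HasCompactSupport V :=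
    ((hasCompactSupport_dz 0 hca1).mul_right (f' := dz 0 b)).sub
      (hca1.mul_right (f' := dz 0 (dz 0 b)))
  have hdW : dz 0 W = a * dz 0 (dz 0 b) - dz 0 (dz 0 a) * b := by
    have hs : W = a * dz 0 b + -(dz 0 a * b) := sub_eq_add_neg _ _
    rw [hs, dz_add 0 (ha.pi_mul hb1) (ha1.pi_mul hb).pi_neg, dz_neg, dz_mul 0 ha hb1, dz_mul 0 ha1 hb]
    ring
  -- Subscripts denoting `∂_1`, antisymmetry in `a, b` reduces the integrand to `ρS_11 W - 2ρ_1 S_1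
  -- W - ρ_1 S W' + ρS V`. Moving the derivative off `W'` produces `∂_1 P` and leaves `(ρS_11 - ρ_1
  -- S_1 + ρ_11 S) W + ρS V`, which is `∂̄_2 Q / z_2`.
  set P : (Fin 2 → ℂ) → ℂ := (-(dz 0 ρ.toFun * ρ.ratio)) * pullFn W with hP
  -- The scalars `1/2` and `-1/2` are kept as constant functions, so that `dzbar_mul` applies to the
  -- scalar multiples too.
  set e : (Fin 2 → ℂ) → ℂ := fun _ => 1 / 2 with he
  have hes : ContDiff ℝ ∞ e := contDiff_const
  set n : (Fin 2 → ℂ) → ℂ := fun _ => -(1 / 2) with hn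
  have hns : ContDiff ℝ ∞ n := contDiff_const
  set E1 : (Fin 2 → ℂ) → ℂ :=
    ρ.toFun * dz 0 (dz 0 ρ.toFun) + n * (dz 0 ρ.toFun * dz 0 ρ.toFun) with hE1
  set E2 : (Fin 2 → ℂ) → ℂ := e * (ρ.toFun * ρ.toFun) with hE2
  have hE1s : ContDiff ℝ ∞ E1 := (hR.pi_mul hR2).pi_add (hns.pi_mul (hR1.pi_mul hR1))
  have hE2s : ContDiff ℝ ∞ E2 := hes.pi_mul (hR.pi_mul hR)
  have hWp := contDiff_pullFn hWs
  have hVp := contDiff_pullFn hVs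
  have hPs : ContDiff ℝ ∞ P := (hR1.pi_mul hS).pi_neg.mul hWp
  set Q : (Fin 2 → ℂ) → ℂ := E1 * pullFn W + E2 * pullFn V with hQ
  have hQs : ContDiff ℝ ∞ Q := (hE1s.pi_mul hWp).pi_add (hE2s.pi_mul hVp)
  have hρ0 : ∀ z ∉ tsupport ρ.toFun, ρ.toFun z = 0 := fun z hz =>
    image_eq_zero_of_notMem_tsupport hz
  have hρ1 : ∀ z ∉ tsupport ρ.toFun, dz 0 ρ.toFun z = 0 := fun z hz => by
    simp [dz, fderiv_of_notMem_tsupport ℝ hz]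
  have hPc : HasCompactSupport P :=
    ρ.hasCompactSupport_mul_pullFn (fun z hz => by simp [hρ1 z hz]) hcW
  have hQc : HasCompactSupport Q :=
    (ρ.hasCompactSupport_mul_pullFn (fun z hz => by simp [hE1, hρ0 z hz, hρ1 z hz]) hcW).add
      (ρ.hasCompactSupport_mul_pullFn (fun z hz => by simp [hE2, hρ0 z hz]) hcV)
  have hH : ContDiff ℝ ∞ fun z => 1 / 2 * V z := contDiff_const.mul hVs
  -- Near `z_2 = 0` one has `ρ = 1`, so `E1 = 0` and `E2 = 1/2`.
  have hQloc : ∀ z : Fin 2 → ℂ, z 1 = 0 → Q =ᶠ[nhds z] pullFn fun z => 1 / 2 * V z := by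
    intro z hz
    have h2 := vanishesNear_dz 0 (dz_zero 0) ρ.vanishesNear_dz_toFun
    filter_upwards [ρ.eventuallyEq_one hz, ρ.vanishesNear_dz_toFun z hz, h2 z hz] with w h0 h1 h2
    simp [hQ, hE1, hE2, h0, h1, h2, he, pullFn]
  have key : ∀ z, dz 0 (ρ.toFun * pullFn b) z * dz 0 (dz 0 (ρ.ratio * pullFn a)) z -
        dz 0 (ρ.toFun * pullFn a) z * dz 0 (dz 0 (ρ.ratio * pullFn b)) z =
      dz 0 P z + dzbar 1 Q z / z 1 := by
    intro z
    have hS' : ρ.ratio = fun z => dzbar 1 ρ.toFun z / z 1 := rfl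
    have e1 : ∀ c : (Fin 1 → ℂ) → ℂ, ContDiff ℝ ∞ c → dz 0 (dz 0 (ρ.ratio * pullFn c)) =
        dz 0 (dz 0 ρ.ratio) * pullFn c + dz 0 ρ.ratio * pullFn (dz 0 c) +
          (dz 0 ρ.ratio * pullFn (dz 0 c) + ρ.ratio * pullFn (dz 0 (dz 0 c))) := by
      intro c hc
      have hc1 := contDiff_dz 0 hc
      have hC := contDiff_pullFn hc
      have hC1 := contDiff_pullFn hc1
      rw [dz_mul 0 hS hC, dz_zero_pullFn hc, dz_add 0 (hS1.pi_mul hC) (hS.pi_mul hC1),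
        dz_mul 0 hS1 hC, dz_mul 0 hS hC1, dz_zero_pullFn hc, dz_zero_pullFn hc1]
    have e2 : dz 0 P = (-(dz 0 (dz 0 ρ.toFun) * ρ.ratio + dz 0 ρ.toFun * dz 0 ρ.ratio)) *
        pullFn W + (-(dz 0 ρ.toFun * ρ.ratio)) * pullFn (dz 0 W) := by
      rw [hP, dz_mul 0 (hR1.pi_mul hS).pi_neg hWp, dz_neg, dz_mul 0 hR1 hS, dz_zero_pullFn hWs]
    have e3 : dzbar 1 Q = (dzbar 1 ρ.toFun * dz 0 (dz 0 ρ.toFun) +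
          ρ.toFun * dzbar 1 (dz 0 (dz 0 ρ.toFun)) + n * (dzbar 1 (dz 0 ρ.toFun) * dz 0 ρ.toFun +
            dz 0 ρ.toFun * dzbar 1 (dz 0 ρ.toFun))) * pullFn W +
        e * (dzbar 1 ρ.toFun * ρ.toFun + ρ.toFun * dzbar 1 ρ.toFun) * pullFn V := by
      rw [hQ, dzbar_add 1 (hE1s.pi_mul hWp) (hE2s.pi_mul hVp), dzbar_mul 1 hE1s hWp,
        dzbar_mul 1 hE2s hVp, dzbar_one_pullFn hWs, dzbar_one_pullFn hVs, hE1, hE2,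
        dzbar_add 1 (hR.pi_mul hR2) (hns.pi_mul (hR1.pi_mul hR1)), dzbar_mul 1 hR hR2,
        dzbar_mul 1 hns (hR1.pi_mul hR1), dzbar_mul 1 hR1 hR1, dzbar_mul 1 hes (hR.pi_mul hR),
        dzbar_mul 1 hR hR, he, hn, dzbar_const, dzbar_const]
      ring
    rw [e1 a ha, e1 b hb, e2, e3, dz_mul 0 hR hA, dz_mul 0 hR hB, dz_zero_pullFn ha,
      dz_zero_pullFn hb, dz_dz_ratio, dz_ratio, hdW, hS']
    simp only [Pi.add_apply, Pi.mul_apply, Pi.neg_apply, pullFn, hW, hV, Pi.sub_apply, he, hn,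
      div_eq_mul_inv]
    ring
  simp only [key]
  rw [MeasureTheory.integral_add, integral_dz_eq_zero 0 hPs hPc,
    integral_dzbar_div hQs hQc hH hQloc, MeasureTheory.integral_const_mul]
  · simp only [hV, Pi.sub_apply, Pi.mul_apply]
    ring
  · exact (contDiff_dz 0 hPs).continuous.integrable_of_hasCompactSupport
      (hasCompactSupport_dz 0 hPc)
  · exact ((vanishesNear_dzbar 1 (dzbar_one_pullFn hH) hQloc).contDiff_div
      (contDiff_dzbar 1 hQs)).continuous.integrable_of_hasCompactSupport
        (hasCompactSupport_div (hasCompactSupport_dzbar 1 hQc))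

end Bump

/-! ### Pullback of cochains of low arity -/

section Pullback

variable {L L' : ℤ → Type} (s : Taylor L L')

lemma pullback_smul (c : ℂ) (Φ : Cochain L') (xs : List (Σ p, L p)) :
    pullback s (c • Φ) xs = c * pullback s Φ xs := by
  induction hn : xs.length using Nat.strong_induction_on generalizing xs Φ with
  | _ n ih =>
    cases xs with
    | nil => simp [pullback]
    | cons x xs =>
      have h1 := ih _ (by simp [← hn]) (fun l => Φ (⟨x.1, s.one x.1 x.2⟩ :: l)) xs rfl
      have h2 := fun j : Fin xs.length =>
        ih _ (by simpa [← hn] using Nat.lt_succ_of_le (List.length_eraseIdx_le _ _))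
          (fun l => Φ (⟨_, s.two x.1 (xs.get j).1 x.2 (xs.get j).2⟩ :: l)) (xs.eraseIdx j) rfl
      rw [pullback, pullback, mul_add, Finset.mul_sum]
      refine congrArg₂ _ h1 (Finset.sum_congr rfl fun j _ => ?_)
      rw [mul_left_comm]
      exact congrArg _ (h2 j)

lemma pullback_eq_zero {Φ : Cochain L'} (h : ∀ l, Φ l = 0) (xs : List (Σ p, L p)) :
    pullback s Φ xs = 0 := by
  have : Φ = (0 : ℂ) • Φ := by
    funext l
    simp [h l]
  rw [this, pullback_smul, zero_mul]

lemma pullback_cons_eq_zero {Φ : Cochain L'} (h : ∀ x l, Φ (x :: l) = 0) (x : Σ p, L p)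
    (xs : List (Σ p, L p)) : pullback s Φ (x :: xs) = 0 := by
  rw [pullback, pullback_eq_zero s fun l => h _ l, zero_add]
  exact Finset.sum_eq_zero fun j _ => by rw [pullback_eq_zero s fun l => h _ l, mul_zero]

/-- This evaluates the inner pullback once the first slot of a cochain of arity two has been filled.
-/
lemma pullback_of_arity_one {Φ : Cochain L'} (h0 : Φ [] = 0) (h : ∀ x y l, Φ (x :: y :: l) = 0)
    (h2 : ∀ p q (α : L p) (β : L q), Φ [⟨_, s.two p q α β⟩] = 0) (xs : List (Σ p, L p)) :
    pullback s Φ xs = match xs with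
      | [x] => Φ [⟨x.1, s.one x.1 x.2⟩]
      | _ => 0 := by
  match xs with
  | [] => simpa [pullback] using h0
  | [x] => simp [pullback]
  | x :: y :: xs =>
    rw [pullback, pullback_cons_eq_zero s fun z l => h _ z l, zero_add]
    refine Finset.sum_eq_zero fun j _ => ?_
    rw [mul_eq_zero]
    right
    generalize (y :: xs).eraseIdx j = l
    cases l with
    | nil =>
      rw [pullback]
      exact h2 _ _ _ _
    | cons z l => exact pullback_cons_eq_zero s (fun z l => h _ z l) z l

lemma pullback_of_arity_two {Φ : Cochain L'} (h : ∀ l, l.length ≠ 2 → Φ l = 0)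
    (h12 : ∀ p q r (α : L p) (β : L q) (γ : L r),
      Φ [⟨_, s.one p α⟩, ⟨_, s.two q r β γ⟩] = 0)
    (h21 : ∀ p q r (α : L p) (β : L q) (γ : L r),
      Φ [⟨_, s.two p q α β⟩, ⟨_, s.one r γ⟩] = 0)
    (h22 : ∀ p q r t (α : L p) (β : L q) (γ : L r) (δ : L t),
      Φ [⟨_, s.two p q α β⟩, ⟨_, s.two r t γ δ⟩] = 0) (xs : List (Σ p, L p)) :
    pullback s Φ xs = match xs with
      | [x, y] => Φ [⟨x.1, s.one x.1 x.2⟩, ⟨y.1, s.one y.1 y.2⟩]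
      | _ => 0 := by
  match xs with
  | [] => simpa [pullback] using h [] (by simp)
  | x :: xs =>
    have h3 : ∀ (u x y : Σ p, L' p) l, Φ (u :: x :: y :: l) = 0 := fun u x y l =>
      h _ (by rw [List.length_cons, List.length_cons, List.length_cons]; omega)
    rw [pullback, pullback_of_arity_one s (Φ := fun l => Φ (⟨x.1, s.one x.1 x.2⟩ :: l))
      (h _ (by simp)) (h3 _) (fun q r β γ => h12 _ _ _ _ _ _), Finset.sum_eq_zero, add_zero]
    · match xs with
      | [] => rfl
      | [y] => rfl
      | y :: z :: l => rfl
    · intro j _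
      rw [pullback_of_arity_one s
        (Φ := fun l => Φ (⟨_, s.two x.1 (xs.get j).1 x.2 (xs.get j).2⟩ :: l))
        (h _ (by simp)) (h3 _) (fun r t γ δ => h22 _ _ _ _ _ _ _ _), mul_eq_zero]
      right
      split
      · exact h21 _ _ _ _ _ _
      · rfl

end Pullback

lemma quadratic_of_length_ne_two {L : ℤ → Type} (K : ∀ p q : ℤ, L p → L q → ℂ)
    (l : List (Σ p, L p)) (h : l.length ≠ 2) : quadratic K l = 0 := by
  match l with
  | [] => rfl
  | [x] => rfl
  | [x, y] => simp at h
  | x :: y :: z :: l => rfl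

/-! ### The pullback of `ψ^i` along `s_ρ` has no components of higher arity -/

lemma psiIntegral_eq_zero_of_lacks (i : Fin 2) {p q : ℤ} {X : VF2 p} {Y : VF2 q}
    (hX : ∀ j, Lacks (1, true) (X.xi j).1) (hY : ∀ j, Lacks (1, true) (Y.xi' j).1) :
    psiIntegral i X Y = 0 := by
  have h1 : Lacks (1, true) (jacobian X.xi).trace := Lacks.sum fun j _ => (hX j).lieDz j
  have h2 : Lacks (1, true) (jacobian Y.xi').trace := Lacks.sum fun j _ => (hY j).lieDz j
  have h3 : Lacks (1, true) (gen ((i, false) : Gen 2)) := lacks_mono (by simp) _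
  rw [psiIntegral, ((h1.wedge h2.del).wedge h3).integral_eq_zero, mul_zero]

lemma psiIntegral_eq_zero_of_xi (i : Fin 2) {p q : ℤ} {X : VF2 p} {Y : VF2 q}
    (hX : ∀ j, (X.xi j).1 = 0) : psiIntegral i X Y = 0 := by
  have h1 : (jacobian X.xi).trace = 0 := by
    simp [Matrix.trace, jacobian, hX]
  rw [psiIntegral, h1]
  simp

namespace Bump

variable (ρ : Bump)

lemma lacks_s1_xi {p : ℤ} (α : VF1 p) (j : Fin 2) : Lacks (1, true) ((ρ.s1 α).xi j).1 := by
  fin_cases j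
  · exact (lacks_mono (by simp) ρ.toFun).wedge (lacks_pull α.1)
  · exact lacks_zero _

lemma s_two_xi {p q : ℤ} (α : VF1 p) (β : VF1 q) (j : Fin 2) :
    ((ρ.s.two p q α β).xi j).1 = 0 :=
  smul_zero _

lemma lacks_s_two_xi' {p q : ℤ} (α : VF1 p) (β : VF1 q) (j : Fin 2) :
    Lacks (1, true) ((ρ.s.two p q α β).xi' j).1 := by
  refine Lacks.smul (σ := ((ρ.s2 α β).xi' j).1) ?_ _
  fin_cases j
  · exact (lacks_mono (by simp) ρ.homotopy).wedge (lacks_pull (bracket α β).1)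
  · exact lacks_zero _

/-- A value of `s_ρ^{(2)}` has no `ξ` part, so it can only enter through `ξ'`. Paired there with
`s_ρ^{(1)}`, it leaves an integrand without `dz̄_2`. -/
theorem pullback_psi (i : Fin 2) (xs : List (Σ p, VF1 p)) :
    pullback ρ.s (psi i) xs = match xs with
      | [x, y] => psi i [⟨x.1, ρ.s1 x.2⟩, ⟨y.1, ρ.s1 y.2⟩]
      | _ => 0 := by
  have h0 : ∀ (p q r : ℤ) (α : VF1 p) (β : VF1 q) (Y : VF2 r),
      psiIntegral i (ρ.s.two p q α β) Y = 0 := fun p q r α β Y =>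
    psiIntegral_eq_zero_of_xi i (ρ.s_two_xi α β)
  have h1 : ∀ (p q r : ℤ) (α : VF1 p) (β : VF1 q) (γ : VF1 r),
      psiIntegral i (ρ.s.one p α) (ρ.s.two q r β γ) = 0 := fun p q r α β γ =>
    psiIntegral_eq_zero_of_lacks i (ρ.lacks_s1_xi α) (ρ.lacks_s_two_xi' β γ)
  rw [pullback_of_arity_two ρ.s (Φ := psi i) (quadratic_of_length_ne_two _)]
  · match xs with
    | [] => rfl
    | [x] => rfl
    | [x, y] => rfl
    | x :: y :: z :: l => rfl
  · intro p q r α β γ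
    simp [psi, quadratic, h0, h1]
  · intro p q r α β γ
    simp [psi, quadratic, h0, h1]
  · intro p q r t α β γ δ
    simp [psi, quadratic, h0]

end Bump

/-! ### Evaluation of the cochains in arity two -/

/-- The sign of `e_I ∧ dz_k ∧ e_J ∧ dz_i`, relative to the standard order of the generators. -/
def blockSign {d : ℕ} (I J : Finset (Gen d)) (k i : Fin d) : ℤ :=
  wedgeSign (I ∪ ({(k, false)} ∪ J)) {(i, false)} * wedgeSign I ({(k, false)} ∪ J) *
    wedgeSign {(k, false)} J

/-- The form `e_I ∧ dz_k ∧ e_J ∧ dz_i` is of top degree, and not zero. -/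
abbrev IsTop {d : ℕ} (I J : Finset (Gen d)) (k i : Fin d) : Prop :=
  Disjoint {(k, false)} J ∧ Disjoint I ({(k, false)} ∪ J) ∧
    Disjoint (I ∪ ({(k, false)} ∪ J)) {(i, false)} ∧
      Finset.univ = I ∪ ({(k, false)} ∪ J) ∪ {(i, false)}

/-- Of the two summands of `∂`, the one with `dz_i` dies against the last factor. The remaining
conditions and signs on index sets are finite and left to `decide`. -/
lemma wedge_top (I J : Finset (Gen 2)) {i k : Fin 2} (hik : k ≠ i) (f g : (Fin 2 → ℂ) → ℂ)
    (z : Fin 2 → ℂ) :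
    wedge (wedge (mono I f) (del (mono J g))) (gen (i, false)) Finset.univ z =
      if IsTop I J k i then blockSign I J k i * (f z * dz k g z) else 0 := by
  have hterm : ∀ l : Fin 2, wedge (wedge (mono I f) (wedge (gen (l, false)) (lieDz l (mono J g))))
      (gen (i, false)) Finset.univ z =
      if IsTop I J l i then blockSign I J l i * (f z * dz l g z) else 0 := by
    intro l
    rw [gen_eq_mono, gen_eq_mono, lieDz_mono]
    by_cases h1 : Disjoint {(l, false)} J
    · rw [wedge_mono_of_disjoint h1]
      by_cases h2 : Disjoint I ({(l, false)} ∪ J)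
      · rw [wedge_mono_of_disjoint h2]
        by_cases h3 : Disjoint (I ∪ ({(l, false)} ∪ J)) {(i, false)}
        · rw [wedge_mono_of_disjoint h3, mono]
          by_cases h4 : Finset.univ = I ∪ ({(l, false)} ∪ J) ∪ {(i, false)}
          · rw [if_pos h4, if_pos ⟨h1, h2, h3, h4⟩, blockSign]
            push_cast
            simp only [Pi.one_apply]
            ring
          · rw [if_neg h4, if_neg fun h => h4 h.2.2.2]
            rfl
        · rw [wedge_mono_of_not_disjoint h3, if_neg fun h => h3 h.2.2.1]
          rfl
      · rw [wedge_mono_of_not_disjoint h2, zero_wedge, if_neg fun h => h2 h.2.1]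
        rfl
    · rw [wedge_mono_of_not_disjoint h1, wedge_zero, zero_wedge, if_neg fun h => h1 h.1]
      rfl
  have hi : ¬IsTop I J i i := fun h => by
    have := h.2.2.1
    simp at this
  have hsum : del (mono J g) = wedge (gen (k, false)) (lieDz k (mono J g)) +
      wedge (gen (i, false)) (lieDz i (mono J g)) := by
    rw [del, Fin.sum_univ_two]
    fin_cases i <;> fin_cases k <;> first | exact absurd rfl hik | rfl | exact add_comm _ _
  rw [hsum, wedge_add, add_wedge, Pi.add_apply, Pi.add_apply, hterm, hterm, if_neg hi, add_zero]

lemma wedge_top_one (I J : Finset (Gen 1)) (f g : (Fin 1 → ℂ) → ℂ) :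
    integral (wedge (mono I f) (del (mono J g))) =
      if Disjoint {((0 : Fin 1), false)} J ∧ Disjoint I ({(0, false)} ∪ J) ∧
          Finset.univ = I ∪ ({(0, false)} ∪ J) then
        -2 * Complex.I * (wedgeSign I ({(0, false)} ∪ J) * wedgeSign {((0 : Fin 1), false)} J) *
          ∫ z, f z * dz 0 g z
      else 0 := by
  rw [del, Fin.sum_univ_one, gen_eq_mono, lieDz_mono]
  by_cases h1 : Disjoint {((0 : Fin 1), false)} J
  · rw [wedge_mono_of_disjoint h1]
    by_cases h2 : Disjoint I ({(0, false)} ∪ J)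
    · rw [wedge_mono_of_disjoint h2, integral_mono]
      by_cases h3 : Finset.univ = I ∪ ({(0, false)} ∪ J)
      · rw [if_pos h3, if_pos ⟨h1, h2, h3⟩, pow_one, mul_assoc (-2 * Complex.I)]
        refine congrArg (HMul.hMul _) ?_
        rw [← MeasureTheory.integral_const_mul]
        congr 1
        funext z
        simp only [Pi.one_apply]
        ring
      · rw [if_neg h3, if_neg fun h => h3 h.2.2]
    · rw [wedge_mono_of_not_disjoint h2, integral_zero, if_neg fun h => h2 h.2.1]
  · rw [wedge_mono_of_not_disjoint h1, wedge_zero, integral_zero, if_neg fun h => h1 h.1]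

/-! ### Values of the bilinear form behind `ψ_2d` -/

section TwoDimensional

variable (α α' : VF1 0) (β β' : VF1 1)

lemma psi2dIntegral_zero_one : psi2dIntegral α β =
    -(1 / Real.pi) * ∫ z, dz 0 (α.1 ∅) z * dz 0 (dz 0 (β.1 {(0, true)})) z := by
  have hs : wedgeSign (∅ : Finset (Gen 1)) ({(0, false)} ∪ {(0, true)}) *
      wedgeSign {((0 : Fin 1), false)} {(0, true)} = 1 := by decide
  rw [psi2dIntegral, eq_mono_of_mem_dolb_zero α.2, eq_mono_of_mem_dolb_one β.2, lieDz_mono,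
    lieDz_mono, wedge_top_one, if_pos (by decide), ← Int.cast_mul, hs, mono_self, mono_self]
  have hπ : (Real.pi : ℂ) ≠ 0 := by exact_mod_cast Real.pi_ne_zero
  have hI := Complex.I_ne_zero
  push_cast
  field_simp

lemma psi2dIntegral_one_zero : psi2dIntegral β α =
    (1 / Real.pi) * ∫ z, dz 0 (β.1 {(0, true)}) z * dz 0 (dz 0 (α.1 ∅)) z := by
  have hs : wedgeSign ({(0, true)} : Finset (Gen 1)) ({(0, false)} ∪ ∅) *
      wedgeSign {((0 : Fin 1), false)} ∅ = -1 := by decide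
  rw [psi2dIntegral, eq_mono_of_mem_dolb_zero α.2, eq_mono_of_mem_dolb_one β.2, lieDz_mono,
    lieDz_mono, wedge_top_one, if_pos (by decide), ← Int.cast_mul, hs, mono_self, mono_self]
  have hπ : (Real.pi : ℂ) ≠ 0 := by exact_mod_cast Real.pi_ne_zero
  have hI := Complex.I_ne_zero
  push_cast
  field_simp

lemma psi2dIntegral_zero_zero : psi2dIntegral α α' = 0 := by
  rw [psi2dIntegral, eq_mono_of_mem_dolb_zero α.2, eq_mono_of_mem_dolb_zero α'.2, lieDz_mono,
    lieDz_mono, wedge_top_one, if_neg (by decide), mul_zero]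

lemma psi2dIntegral_one_one : psi2dIntegral β β' = 0 := by
  rw [psi2dIntegral, eq_mono_of_mem_dolb_one β.2, eq_mono_of_mem_dolb_one β'.2, lieDz_mono,
    lieDz_mono, wedge_top_one, if_neg (by decide), mul_zero]

lemma psi2dIntegral_eq_zero_left {p q : ℤ} {α : VF1 p} {β : VF1 q} (h : α.1 = 0) :
    psi2dIntegral α β = 0 := by
  simp [psi2dIntegral, h]

lemma psi2dIntegral_eq_zero_right {p q : ℤ} {α : VF1 p} {β : VF1 q} (h : β.1 = 0) :
    psi2dIntegral α β = 0 := by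
  simp [psi2dIntegral, h]

end TwoDimensional

/-- Since `I ≠ J`, each coefficient comes from at most one summand, so additivity of the derivative,
and with it smoothness, is not needed. -/
lemma lieDz_add_mono {d : ℕ} (k : Fin d) {I J : Finset (Gen d)} (h : I ≠ J)
    (f g : (Fin d → ℂ) → ℂ) :
    lieDz k (mono I f + mono J g) = mono I (dz k f) + mono J (dz k g) := by
  funext K
  by_cases h1 : K = I
  · have h2 : K ≠ J := h1 ▸ h
    simp [lieDz, mono, h1, h]
  · by_cases h2 : K = J
    · simp [lieDz, mono, h2, Ne.symm h]
    · simp [lieDz, mono, h1, h2, dz_zero]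

lemma del_add_mono {d : ℕ} {I J : Finset (Gen d)} (h : I ≠ J) (f g : (Fin d → ℂ) → ℂ) :
    del (mono I f + mono J g) = del (mono I f) + del (mono J g) := by
  simp only [del, lieDz_add_mono _ h, lieDz_mono, wedge_add, Finset.sum_add_distrib]

/-! ### Values of `ψ^i` on the linear component of `s_ρ` -/

namespace Bump

variable (ρ : Bump)

/-- The coefficient of `dz̄_1` in `∂̄ρ / z_2`. -/
def ratioOne : (Fin 2 → ℂ) → ℂ := fun z => dzbar 0 ρ.toFun z / z 1

lemma delbarDiv_eq :
    ρ.delbarDiv = mono {(0, true)} ρ.ratioOne + mono {(1, true)} ρ.ratio := by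
  have h : ∀ k : Fin 2, wedge (gen (k, true)) (lieDzbar k (fn ρ.toFun)) =
      mono {(k, true)} (dzbar k ρ.toFun) := by
    intro k
    have hs : wedgeSign {((k : Fin 2), true)} ∅ = 1 := by simp [wedgeSign]
    rw [gen_eq_mono, fn_eq_mono, lieDzbar_mono, wedge_mono_of_disjoint (by simp), hs]
    simp
  funext I z
  rw [delbarDiv, delbar, Fin.sum_univ_two, h, h]
  simp only [Pi.add_apply, mono, add_div]
  congr 1 <;> split_ifs <;> simp [ratioOne, ratio]

lemma cut_zero (α : VF1 0) : (ρ.cut α).1 = mono ∅ (ρ.toFun * pullFn (α.1 ∅)) := by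
  have hs : wedgeSign (∅ : Finset (Gen 2)) ∅ = 1 := by decide
  change wedge (fn ρ.toFun) (pull _) = _
  rw [eq_mono_of_mem_dolb_zero α.2]
  simp only [pull_mono, fn_eq_mono, Finset.image_empty, mono_self]
  rw [wedge_mono_of_disjoint (by decide), hs]
  simp
  rfl

lemma cut_one (β : VF1 1) :
    (ρ.cut β).1 = mono {(0, true)} (ρ.toFun * pullFn (β.1 {(0, true)})) := by
  have hs : wedgeSign (∅ : Finset (Gen 2)) {(0, true)} = 1 := by decide
  change wedge (fn ρ.toFun) (pull _) = _
  rw [eq_mono_of_mem_dolb_one β.2]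
  simp only [pull_mono, fn_eq_mono, Finset.image_singleton, mono_self]
  rw [wedge_mono_of_disjoint (by decide), hs]
  simp
  rfl

lemma cut'_zero (α : VF1 0) : (ρ.cut' α).1 =
    mono {(0, true)} (ρ.ratioOne * pullFn (α.1 ∅)) +
      mono {(1, true)} (ρ.ratio * pullFn (α.1 ∅)) := by
  have hs : wedgeSign {((0 : Fin 2), true)} ∅ = 1 := by decide
  have hs' : wedgeSign {((1 : Fin 2), true)} ∅ = 1 := by decide
  change wedge ρ.delbarDiv (pull _) = _
  rw [eq_mono_of_mem_dolb_zero α.2]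
  simp only [pull_mono, Finset.image_empty, mono_self, delbarDiv_eq, add_wedge]
  rw [wedge_mono_of_disjoint (by decide), wedge_mono_of_disjoint (by decide), hs, hs']
  simp
  rfl

/-- The `dz̄_1` part of `∂̄ρ / z_2` is killed by `β`; the sign is that of `dz̄_2 ∧ dz̄_1`. -/
lemma cut'_one (β : VF1 1) : (ρ.cut' β).1 =
    -mono {(0, true), (1, true)} (ρ.ratio * pullFn (β.1 {(0, true)})) := by
  have hs : wedgeSign {((1 : Fin 2), true)} {(0, true)} = -1 := by decide
  have hu : ({((1 : Fin 2), true)} : Finset (Gen 2)) ∪ {(0, true)} = {(0, true), (1, true)} := by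
    decide
  change wedge ρ.delbarDiv (pull _) = _
  rw [eq_mono_of_mem_dolb_one β.2, neg_mono]
  simp only [pull_mono, Finset.image_singleton, mono_self, delbarDiv_eq, add_wedge]
  rw [wedge_mono_of_not_disjoint (by decide), wedge_mono_of_disjoint (by decide), hs, hu, zero_add]
  congr 1
  funext z
  simp [pullFn]

lemma psiIntegral_s1 (i : Fin 2) {p q : ℤ} (α : VF1 p) (β : VF1 q) :
    psiIntegral i (ρ.s1 α) (ρ.s1 β) = 1 / (2 * Real.pi * Complex.I) ^ 2 *
      integral (wedge (wedge (lieDz 0 (ρ.cut α).1) (del (lieDz 0 (-(ρ.cut' β).1))))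
        (gen (i, false))) := by
  have h1 : (jacobian (ρ.s1 α).xi).trace = lieDz 0 (ρ.cut α).1 := by
    simp [Matrix.trace, jacobian, s1]
  have h2 : (jacobian (ρ.s1 β).xi').trace = lieDz 0 (-(ρ.cut' β).1) := by
    simp [Matrix.trace, jacobian, s1]
  rw [psiIntegral, h1, h2]

lemma const_eq : 1 / (2 * Real.pi * Complex.I) ^ 2 * (-2 * Complex.I) ^ 2 =
    (1 / Real.pi ^ 2 : ℂ) := by
  have hπ : (Real.pi : ℂ) ≠ 0 := by exact_mod_cast Real.pi_ne_zero
  have hI := Complex.I_ne_zero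
  field_simp

variable {i k : Fin 2} (α α' : VF1 0) (β β' : VF1 1)

lemma psiIntegral_zero_one (hik : k ≠ i) : psiIntegral i (ρ.s1 α) (ρ.s1 β) =
    (1 / Real.pi ^ 2 : ℂ) * (blockSign ∅ {(0, true), (1, true)} k i *
      ∫ z, dz 0 (ρ.toFun * pullFn (α.1 ∅)) z *
        dz k (dz 0 (ρ.ratio * pullFn (β.1 {(0, true)}))) z) := by
  have ht : ∀ k i : Fin 2, k ≠ i → IsTop ∅ {(0, true), (1, true)} k i := by decide
  rw [psiIntegral_s1, cut_zero, cut'_one, neg_neg, lieDz_mono, lieDz_mono, integral, ← mul_assoc,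
    const_eq]
  refine congrArg (HMul.hMul _) ?_
  rw [← MeasureTheory.integral_const_mul]
  congr 1
  funext z
  rw [wedge_top _ _ hik, if_pos (ht k i hik)]

lemma psiIntegral_one_zero (hik : k ≠ i) : psiIntegral i (ρ.s1 β) (ρ.s1 α) =
    (1 / Real.pi ^ 2 : ℂ) * (-blockSign {(0, true)} {(1, true)} k i *
      ∫ z, dz 0 (ρ.toFun * pullFn (β.1 {(0, true)})) z *
        dz k (dz 0 (ρ.ratio * pullFn (α.1 ∅))) z) := by
  have ht : ∀ k i : Fin 2, k ≠ i → IsTop {(0, true)} {(1, true)} k i := by decide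
  -- The `dz̄_1` part of `∂̄ρ / z_2` meets the `dz̄_1` of `β`, so `ratioOne` drops out.
  have hf : ¬IsTop {(0, true)} {(0, true)} k i := fun h => by
    have := h.2.1
    simp at this
  rw [psiIntegral_s1, cut_one, cut'_zero, neg_add, neg_mono, neg_mono, lieDz_mono,
    lieDz_add_mono _ (by decide), del_add_mono (by decide), integral, ← mul_assoc,
    const_eq]
  refine congrArg (HMul.hMul _) ?_
  rw [← MeasureTheory.integral_const_mul]
  congr 1
  funext z
  rw [wedge_add, add_wedge, Pi.add_apply, Pi.add_apply, wedge_top _ _ hik, wedge_top _ _ hik,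
    if_neg hf, if_pos (ht k i hik), dz_neg, dz_neg, zero_add, Pi.neg_apply]
  ring

lemma psiIntegral_zero_zero (hik : k ≠ i) : psiIntegral i (ρ.s1 α) (ρ.s1 α') = 0 := by
  have ht : ∀ k i : Fin 2, ¬IsTop ∅ {(0, true)} k i ∧ ¬IsTop ∅ {(1, true)} k i := by decide
  rw [psiIntegral_s1, cut_zero, cut'_zero, neg_add, neg_mono, neg_mono, lieDz_mono,
    lieDz_add_mono _ (by decide), del_add_mono (by decide), integral, wedge_add, add_wedge]
  simp only [Pi.add_apply, wedge_top _ _ hik, if_neg (ht k i).1, if_neg (ht k i).2]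
  simp

lemma psiIntegral_one_one (hik : k ≠ i) : psiIntegral i (ρ.s1 β) (ρ.s1 β') = 0 := by
  have ht : ¬IsTop {(0, true)} {(0, true), (1, true)} k i := fun h => by
    have := h.2.1
    simp at this
  rw [psiIntegral_s1, cut_one, cut'_one, neg_neg, lieDz_mono, lieDz_mono, integral]
  simp only [wedge_top _ _ hik, if_neg ht]
  simp

lemma psiIntegral_eq_zero_left {p q : ℤ} {α : VF1 p} {β : VF1 q} (h : α.1 = 0) :
    psiIntegral i (ρ.s1 α) (ρ.s1 β) = 0 := by
  simp [psiIntegral_s1, cut, h, pull_zero]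

lemma psiIntegral_eq_zero_right {p q : ℤ} {α : VF1 p} {β : VF1 q} (h : β.1 = 0) :
    psiIntegral i (ρ.s1 α) (ρ.s1 β) = 0 := by
  simp [psiIntegral_s1, cut', h, pull_zero]

end Bump

/-- A one-form has degree `0` in `L[1]`, so no Koszul sign arises when it is exchanged with a
function. -/
lemma quadratic_comm_of_even {L : ℤ → Type} (K : ∀ p q : ℤ, L p → L q → ℂ) {p q : ℤ} (x : L p)
    (y : L q) (h : (p - 1) * (q - 1) = 0) :
    quadratic K [⟨p, x⟩, ⟨q, y⟩] = quadratic K [⟨q, y⟩, ⟨p, x⟩] := by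
  have h' : (q - 1) * (p - 1) = 0 := by rw [mul_comm, h]
  simp only [quadratic, h, h']
  simp [add_comm]

lemma psi2d_zero_one (α : VF1 0) (β : VF1 1) : psi2d [⟨0, α⟩, ⟨1, β⟩] =
    (1 / Real.pi : ℂ) * ∫ z, (dz 0 (dz 0 (α.1 ∅)) z * dz 0 (β.1 {(0, true)}) z -
      dz 0 (α.1 ∅) z * dz 0 (dz 0 (β.1 {(0, true)})) z) := by
  have ha := α.2.1 ∅
  have hb := β.2.1 {(0, true)}
  have ha1 := contDiff_dz 0 ha
  have hb1 := contDiff_dz 0 hb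
  have hc := hasCompactSupport_dz 0 (α.2.2.1 ∅)
  rw [MeasureTheory.integral_sub]
  · simp only [psi2d, quadratic, psi2dIntegral_zero_one, psi2dIntegral_one_zero]
    simp only [mul_comm (dz 0 (β.1 {(0, true)}) _)]
    norm_num
    ring
  · exact ((contDiff_dz 0 ha1).mul hb1).continuous.integrable_of_hasCompactSupport
      ((hasCompactSupport_dz 0 hc).mul_right (f' := dz 0 (β.1 {(0, true)})))
  · exact (ha1.mul (contDiff_dz 0 hb1)).continuous.integrable_of_hasCompactSupport
      (hc.mul_right (f' := dz 0 (dz 0 (β.1 {(0, true)}))))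

/-- Two quadratic cochains which vanish on pairs of forms of the same degree agree in arity two if
they agree on all pairs of a function and a one-form. -/
lemma eq_of_eq_zero_one {K K' : ∀ p q : ℤ, VF1 p → VF1 q → ℂ}
    (hl : ∀ p q (α : VF1 p) (β : VF1 q), α.1 = 0 → K p q α β = 0)
    (hr : ∀ p q (α : VF1 p) (β : VF1 q), β.1 = 0 → K p q α β = 0)
    (h00 : ∀ α β : VF1 0, K 0 0 α β = 0) (h11 : ∀ α β : VF1 1, K 1 1 α β = 0)
    (hl' : ∀ p q (α : VF1 p) (β : VF1 q), α.1 = 0 → K' p q α β = 0)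
    (hr' : ∀ p q (α : VF1 p) (β : VF1 q), β.1 = 0 → K' p q α β = 0)
    (h00' : ∀ α β : VF1 0, K' 0 0 α β = 0) (h11' : ∀ α β : VF1 1, K' 1 1 α β = 0)
    (h : ∀ (α : VF1 0) (β : VF1 1),
      quadratic K [⟨0, α⟩, ⟨1, β⟩] = quadratic K' [⟨0, α⟩, ⟨1, β⟩]) (x y : Σ p, VF1 p) :
    quadratic K [x, y] = quadratic K' [x, y] := by
  obtain ⟨p, α⟩ := x
  obtain ⟨q, β⟩ := y
  by_cases hα : α.1 = 0
  · simp [quadratic, hl _ _ _ _ hα, hl' _ _ _ _ hα, hr _ _ _ _ hα, hr' _ _ _ _ hα]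
  by_cases hβ : β.1 = 0
  · simp [quadratic, hl _ _ _ _ hβ, hl' _ _ _ _ hβ, hr _ _ _ _ hβ, hr' _ _ _ _ hβ]
  have hp : p = 0 ∨ p = 1 := by
    by_contra! hp
    exact hα (eq_zero_of_mem_dolb_one α.2 hp.1 hp.2)
  have hq : q = 0 ∨ q = 1 := by
    by_contra! hq
    exact hβ (eq_zero_of_mem_dolb_one β.2 hq.1 hq.2)
  rcases hp with rfl | rfl <;> rcases hq with rfl | rfl
  · simp [quadratic, h00, h00']
  · exact h α β
  · rw [quadratic_comm_of_even K _ _ (by norm_num), quadratic_comm_of_even K' _ _ (by norm_num)]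
    exact h β α
  · simp [quadratic, h11, h11']

/-! ### The two pullback identities -/

namespace Bump

variable (ρ : Bump)

/-- The bilinear function which is the arity two component of the pullback of `ψ^i`. -/
def psiPull (i : Fin 2) (p q : ℤ) (α : VF1 p) (β : VF1 q) : ℂ :=
  (-1 : ℂ) ^ ((p - 1) * (q + 2) + (p - 1) + (q - 1)) * psiIntegral i (ρ.s1 α) (ρ.s1 β)

lemma psi_s1 (i : Fin 2) (x y : Σ p, VF1 p) :
    psi i [⟨x.1, ρ.s1 x.2⟩, ⟨y.1, ρ.s1 y.2⟩] = quadratic (ρ.psiPull i) [x, y] := rfl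

/-- Common reduction for both identities: `K` will be the bilinear form of `-ψ_2d / 2` for `i = 1`,
and zero for `i = 0`. -/
theorem psi_s1_eq {i k : Fin 2} (hik : k ≠ i) {K : ∀ p q : ℤ, VF1 p → VF1 q → ℂ}
    (hl : ∀ p q (α : VF1 p) (β : VF1 q), α.1 = 0 → K p q α β = 0)
    (hr : ∀ p q (α : VF1 p) (β : VF1 q), β.1 = 0 → K p q α β = 0)
    (h00 : ∀ α β : VF1 0, K 0 0 α β = 0) (h11 : ∀ α β : VF1 1, K 1 1 α β = 0)
    (h : ∀ (α : VF1 0) (β : VF1 1),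
      quadratic (ρ.psiPull i) [⟨0, α⟩, ⟨1, β⟩] = quadratic K [⟨0, α⟩, ⟨1, β⟩]) :
    pullback ρ.s (psi i) = quadratic K := by
  funext xs
  rw [ρ.pullback_psi]
  match xs with
  | [] => rfl
  | [x] => rfl
  | x :: y :: z :: l => rfl
  | [x, y] =>
    refine (ρ.psi_s1 i x y).trans (eq_of_eq_zero_one ?_ ?_ ?_ ?_ hl hr h00 h11 h x y)
    · intro p q α β hα
      simp [psiPull, ρ.psiIntegral_eq_zero_left hα]
    · intro p q α β hβ
      simp [psiPull, ρ.psiIntegral_eq_zero_right hβ]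
    · intro α β
      simp [psiPull, ρ.psiIntegral_zero_zero _ _ hik]
    · intro α β
      simp [psiPull, ρ.psiIntegral_one_one _ _ hik]

lemma hasCompactSupport_toFun_mul {w : (Fin 1 → ℂ) → ℂ} (hw : HasCompactSupport w) :
    HasCompactSupport (ρ.toFun * pullFn w) :=
  ρ.hasCompactSupport_mul_pullFn (fun _ hz => image_eq_zero_of_notMem_tsupport hz) hw

theorem psiPull_one (α : VF1 0) (β : VF1 1) :
    quadratic (ρ.psiPull 1) [⟨0, α⟩, ⟨1, β⟩] = -1 / 2 * psi2d [⟨0, α⟩, ⟨1, β⟩] := by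
  have ha := α.2.1 ∅
  have hb := β.2.1 {(0, true)}
  have hca := α.2.2.1 ∅
  have hcb := β.2.2.1 {(0, true)}
  have hA := contDiff_pullFn ha
  have hB := contDiff_pullFn hb
  have hR := ρ.smooth
  have hS := ρ.contDiff_ratio
  have hs1 : blockSign ∅ {((0 : Fin 2), true), (1, true)} 0 1 = -1 := by decide
  have hs2 : blockSign {((0 : Fin 2), true)} {(1, true)} 0 1 = 1 := by decide
  have key := ρ.integral_transgression ha hb hca
  rw [MeasureTheory.integral_sub] at key
  -- The factor `-(π/2)` creates the right side of `key`, which can then be replaced by the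
  -- integrals over `ℂ²`.
  · rw [psi2d_zero_one, ← mul_right_inj' (a := -(Real.pi / 2 : ℂ)) (by simp [Real.pi_ne_zero]),
      mul_left_comm _ (-1 / 2 : ℂ), mul_left_comm _ (1 / Real.pi : ℂ), ← key]
    simp only [quadratic, psiPull, ρ.psiIntegral_zero_one (k := 0) _ _ (zero_ne_one),
      ρ.psiIntegral_one_zero (k := 0) _ _ (zero_ne_one), hs1, hs2]
    have hπ : (Real.pi : ℂ) ≠ 0 := by exact_mod_cast Real.pi_ne_zero
    norm_num
    field_simp
    ring
  · exact ((contDiff_dz 0 (hR.pi_mul hB)).mul (contDiff_dz 0 (contDiff_dz 0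
      (hS.pi_mul hA)))).continuous.integrable_of_hasCompactSupport
      ((hasCompactSupport_dz 0 (ρ.hasCompactSupport_toFun_mul hcb)).mul_right
        (f' := dz 0 (dz 0 (ρ.ratio * pullFn (α.1 ∅)))))
  · exact ((contDiff_dz 0 (hR.pi_mul hA)).mul (contDiff_dz 0 (contDiff_dz 0
      (hS.pi_mul hB)))).continuous.integrable_of_hasCompactSupport
      ((hasCompactSupport_dz 0 (ρ.hasCompactSupport_toFun_mul hca)).mul_right
        (f' := dz 0 (dz 0 (ρ.ratio * pullFn (β.1 {(0, true)})))))

theorem pullback_psi_one : pullback ρ.s (psi 1) = (-1 / 2 : ℂ) • psi2d := by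
  have h : (-1 / 2 : ℂ) • psi2d = quadratic fun p q α β =>
      (-1 / 2 : ℂ) * ((-1 : ℂ) ^ ((p - 1) * (q + 1)) * psi2dIntegral α β) := by
    funext xs
    match xs with
    | [] => simp [psi2d, quadratic]
    | [x] => simp [psi2d, quadratic]
    | x :: y :: z :: l => simp [psi2d, quadratic]
    | [x, y] =>
      simp only [psi2d, quadratic, Pi.smul_apply, smul_eq_mul]
      ring
  rw [h]
  refine ρ.psi_s1_eq zero_ne_one ?_ ?_ ?_ ?_ ?_
  · intro p q α β hα
    simp [psi2dIntegral_eq_zero_left hα]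
  · intro p q α β hβ
    simp [psi2dIntegral_eq_zero_right hβ]
  · intro α β
    simp [psi2dIntegral_zero_zero]
  · intro α β
    simp [psi2dIntegral_one_one]
  · intro α β
    rw [← h, ρ.psiPull_one]
    rfl

lemma dz_zero_toFun (h : ∀ z w : Fin 2 → ℂ, z 1 = w 1 → ρ.toFun z = ρ.toFun w) :
    dz 0 ρ.toFun = 0 := by
  have hv : ∀ (z : Fin 2 → ℂ) (c : ℂ), fderiv ℝ ρ.toFun z (Pi.single 0 c) = 0 := by
    intro z c
    rw [← (ρ.smooth.differentiable (by simp) z).lineDeriv_eq_fderiv, lineDeriv]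
    have : (fun t : ℝ => ρ.toFun (z + t • (Pi.single 0 c : Fin 2 → ℂ))) = fun _ => ρ.toFun z := by
      funext t
      exact h _ _ (by simp)
    rw [this, deriv_const]
  funext z
  simp [dz, hv]

theorem pullback_psi_zero (h : ∀ z w : Fin 2 → ℂ, z 1 = w 1 → ρ.toFun z = ρ.toFun w) :
    pullback ρ.s (psi 0) = 0 := by
  have h0 : (0 : Cochain VF1) = quadratic fun _ _ _ _ => 0 := by
    funext xs
    match xs with
    | [] => rfl
    | [x] => rfl
    | x :: y :: z :: l => rfl
    | [x, y] => simp [quadratic]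
  rw [h0]
  refine ρ.psi_s1_eq one_ne_zero (by simp) (by simp) (by simp) (by simp) fun α β => ?_
  rw [← h0, Pi.zero_apply]
  have hR0 := ρ.dz_zero_toFun h
  have hS0 : dz 0 ρ.ratio = 0 := by
    rw [dz_ratio, hR0]
    funext z
    simp [dzbar_zero]
  have hdR : ∀ c : (Fin 1 → ℂ) → ℂ, ContDiff ℝ ∞ c →
      dz 0 (ρ.toFun * pullFn c) = ρ.toFun * pullFn (dz 0 c) := by
    intro c hc
    rw [dz_mul 0 ρ.smooth (contDiff_pullFn hc), hR0, dz_zero_pullFn hc, zero_mul, zero_add]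
  have hdS : ∀ c : (Fin 1 → ℂ) → ℂ, ContDiff ℝ ∞ c →
      dz 1 (dz 0 (ρ.ratio * pullFn c)) = dz 1 ρ.ratio * pullFn (dz 0 c) := by
    intro c hc
    rw [dz_mul 0 ρ.contDiff_ratio (contDiff_pullFn hc), hS0, dz_zero_pullFn hc, zero_mul,
      zero_add, dz_mul 1 ρ.contDiff_ratio (contDiff_pullFn (contDiff_dz 0 hc)),
      dz_one_pullFn (contDiff_dz 0 hc), mul_zero, add_zero]
  have ha := α.2.1 ∅
  have hb := β.2.1 {(0, true)}
  have hs1 : blockSign ∅ {((0 : Fin 2), true), (1, true)} 1 0 = 1 := by decide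
  have hs2 : blockSign {((0 : Fin 2), true)} {(1, true)} 1 0 = -1 := by decide
  -- Both integrands are `ρ (∂_2 S) a' b'`; the signs `hs1`, `hs2` and those in `psiPull` make the
  -- two terms cancel.
  have hint : ∫ z, (ρ.toFun * pullFn (dz 0 (β.1 {(0, true)}))) z *
        (dz 1 ρ.ratio * pullFn (dz 0 (α.1 ∅))) z =
      ∫ z, (ρ.toFun * pullFn (dz 0 (α.1 ∅))) z *
        (dz 1 ρ.ratio * pullFn (dz 0 (β.1 {(0, true)}))) z := by
    congr 1
    funext z
    simp only [Pi.mul_apply]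
    ring
  simp only [quadratic, psiPull, ρ.psiIntegral_zero_one (k := 1) _ _ one_ne_zero,
    ρ.psiIntegral_one_zero (k := 1) _ _ one_ne_zero, hs1, hs2, hdR _ ha, hdR _ hb, hdS _ ha,
    hdS _ hb, hint]
  norm_num

end Bump

/-! ### The cochain `ψ_2d` does not vanish -/

lemma mono_mem_dolb {d : ℕ} {I : Finset (Gen d)} {f : (Fin d → ℂ) → ℂ} (hI : ∀ g ∈ I, g.2 = true)
    (hf : ContDiff ℝ ∞ f) (hc : HasCompactSupport f) : mono I f ∈ Dolb d I.card := by
  refine ⟨fun J => ?_, fun J => ?_, fun J hJ => ?_⟩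
  · by_cases h : J = I
    · simpa [mono, h] using hf
    · rw [mono, if_neg h]
      exact contDiff_const
  · by_cases h : J = I
    · simpa [mono, h] using hc
    · simpa [mono, h] using HasCompactSupport.zero
  · obtain rfl : J = I := by
      by_contra h
      exact hJ (if_neg h)
    exact ⟨hI, rfl⟩

lemma dz_coord_one : dz 0 (fun z : Fin 1 → ℂ => z 0) = 1 := by
  funext z
  have h : fderiv ℝ (fun z : Fin 1 → ℂ => z 0) z =
      ContinuousLinearMap.proj (R := ℝ) (φ := fun _ : Fin 1 => ℂ) 0 :=
    (ContinuousLinearMap.proj (R := ℝ) (φ := fun _ : Fin 1 => ℂ) 0).fderiv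
  simp [dz, h]
  norm_num

/-- There is a test function whose third derivative does not vanish at the origin. -/
lemma exists_test_function : ∃ a : (Fin 1 → ℂ) → ℂ, ContDiff ℝ ∞ a ∧ HasCompactSupport a ∧
    dz 0 (dz 0 (dz 0 a)) 0 ≠ 0 := by
  let χ : ContDiffBump (0 : Fin 1 → ℂ) := ⟨1, 2, one_pos, one_lt_two⟩
  let x : (Fin 1 → ℂ) → ℂ := fun z => z 0
  have hx : ContDiff ℝ ∞ x := contDiff_apply ℝ ℂ (0 : Fin 1)
  let e : (Fin 1 → ℂ) → ℂ := fun z => (χ z : ℂ)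
  have he : ContDiff ℝ ∞ e := Complex.ofRealCLM.contDiff.comp χ.contDiff
  have hce : HasCompactSupport e :=
    χ.hasCompactSupport.comp_left (g := fun t : ℝ => (t : ℂ)) Complex.ofReal_zero
  have hx1 : dz 0 x = 1 := dz_coord_one
  have h1 : dz 0 (1 : (Fin 1 → ℂ) → ℂ) = 0 := dz_const 0 1
  have hxx : dz 0 (x * x) = x + x := by
    rw [dz_mul 0 hx hx, hx1]
    ring
  have hxxx : dz 0 (x * x * x) = (x * x + x * x) + x * x := by
    rw [dz_mul 0 (hx.pi_mul hx) hx, hx1, hxx]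
    ring
  have h2 : dz 0 (dz 0 (dz 0 (x * x * x))) = 6 := by
    rw [hxxx, dz_add 0 ((hx.pi_mul hx).pi_add (hx.pi_mul hx)) (hx.pi_mul hx),
      dz_add 0 (hx.pi_mul hx) (hx.pi_mul hx), hxx,
      dz_add 0 ((hx.pi_add hx).pi_add (hx.pi_add hx)) (hx.pi_add hx),
      dz_add 0 (hx.pi_add hx) (hx.pi_add hx), dz_add 0 hx hx, hx1]
    ring
  -- A cut-off of `z³`, whose third derivative at the origin is `6`.
  refine ⟨e * (x * x * x), he.mul ((hx.mul hx).mul hx), hce.mul_right, ?_⟩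
  have hev : e * (x * x * x) =ᶠ[nhds 0] x * x * x := by
    filter_upwards [χ.eventuallyEq_one] with z hz
    simp [e, hz]
  have hcongr : ∀ {f g : (Fin 1 → ℂ) → ℂ}, f =ᶠ[nhds 0] g → dz 0 f =ᶠ[nhds 0] dz 0 g :=
    fun h => h.eventually_nhds.mono fun z hz => dz_congr 0 hz
  rw [(hcongr (hcongr (hcongr hev))).eq_of_nhds, h2]
  norm_num

theorem exists_psi2d_ne_zero : ∃ x y : Σ p, VF1 p, psi2d [x, y] ≠ 0 := by
  obtain ⟨a, ha, hca, h0⟩ := exists_test_function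
  have ha1 := contDiff_dz 0 ha
  have ha2 := contDiff_dz 0 ha1
  have ha3 := contDiff_dz 0 ha2
  have hca1 := hasCompactSupport_dz 0 hca
  have hca2 := hasCompactSupport_dz 0 hca1
  have hca3 := hasCompactSupport_dz 0 hca2
  set b : (Fin 1 → ℂ) → ℂ := fun z => (starRingEnd ℂ) (dz 0 (dz 0 (dz 0 a)) z) with hb'
  have hb : ContDiff ℝ ∞ b := Complex.conjCLE.contDiff.comp ha3
  have hcb : HasCompactSupport b := hca3.comp_left (map_zero _)
  have hb1 := contDiff_dz 0 hb
  have hα : mono ∅ a ∈ Dolb 1 0 := by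
    simpa using mono_mem_dolb (I := ∅) (by simp) ha hca
  have hβ : mono {(0, true)} b ∈ Dolb 1 1 := by
    simpa using mono_mem_dolb (I := {((0 : Fin 1), true)}) (by simp) hb hcb
  refine ⟨⟨0, ⟨_, hα⟩⟩, ⟨1, ⟨_, hβ⟩⟩, ?_⟩
  rw [psi2d_zero_one]
  simp only [mono_self]
  set N : (Fin 1 → ℂ) → ℝ := fun z => ‖dz 0 (dz 0 (dz 0 a)) z‖ ^ 2 with hN
  -- Since `∂(2a''b - a'b') = 2a'''b + a''b' - a'b''`, the integrand of `ψ_2d` is `∂F - 2|a'''|²`.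
  set F : (Fin 1 → ℂ) → ℂ := dz 0 (dz 0 a) * b + dz 0 (dz 0 a) * b + -(dz 0 a * dz 0 b) with hF
  have hFs : ContDiff ℝ ∞ F :=
    ((ha2.pi_mul hb).pi_add (ha2.pi_mul hb)).pi_add (ha1.pi_mul hb1).pi_neg
  have hFc : HasCompactSupport F :=
    ((hca2.mul_right (f' := b)).add (hca2.mul_right (f' := b))).add
      (hca1.mul_right (f' := dz 0 b)).neg
  have hdF : ∀ z, dz 0 (dz 0 a) z * dz 0 b z - dz 0 a z * dz 0 (dz 0 b) z =
      dz 0 F z - 2 * (N z : ℂ) := by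
    intro z
    have hNz : (N z : ℂ) = dz 0 (dz 0 (dz 0 a)) z * b z := by
      rw [hb', Complex.mul_conj, Complex.normSq_eq_norm_sq]
    rw [hF, dz_add 0 ((ha2.pi_mul hb).pi_add (ha2.pi_mul hb)) (ha1.pi_mul hb1).pi_neg,
      dz_add 0 (ha2.pi_mul hb) (ha2.pi_mul hb), dz_neg, dz_mul 0 ha2 hb, dz_mul 0 ha1 hb1, hNz]
    simp only [Pi.add_apply, Pi.mul_apply, Pi.neg_apply]
    ring
  have hNcont : Continuous N := ha3.continuous.norm.pow 2
  have hNc : HasCompactSupport N :=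
    hca3.comp_left (g := fun w : ℂ => ‖w‖ ^ 2) (by simp)
  have hpos : 0 < ∫ z, N z :=
    hNcont.integral_pos_of_hasCompactSupport_nonneg_nonzero hNc (fun z => by positivity)
      (x := 0) (by simpa [hN] using h0)
  simp only [hdF]
  rw [MeasureTheory.integral_sub, integral_dz_eq_zero 0 hFs hFc,
    MeasureTheory.integral_const_mul, integral_complex_ofReal]
  · have h1 : ((∫ z, N z : ℝ) : ℂ) ≠ 0 := by exact_mod_cast hpos.ne'
    simp [Real.pi_ne_zero, h1]
  · exact (contDiff_dz 0 hFs).continuous.integrable_of_hasCompactSupport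
      (hasCompactSupport_dz 0 hFc)
  · exact ((hNcont.integrable_of_hasCompactSupport hNc).ofReal).const_mul 2

end HigherVir

end

theorem mainTheorem7 (ρ : HigherVir.Bump) :
    HigherVir.pullback ρ.s (HigherVir.psi 1) = (-1 / 2 : ℂ) • HigherVir.psi2d ∧
    ((∀ z w : Fin 2 → ℂ, z 1 = w 1 → ρ.toFun z = ρ.toFun w) →
      HigherVir.pullback ρ.s (HigherVir.psi 0) = 0) ∧
    ∀ c2d c4d : ℂ,
      HigherVir.pullback ρ.s (c4d • HigherVir.psi 1) =
          c2d • ((1 / 24 : ℂ) • HigherVir.psi2d) ↔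
        c2d = -12 * c4d := by
  refine ⟨ρ.pullback_psi_one, ρ.pullback_psi_zero, fun c2d c4d => ?_⟩
  have h : HigherVir.pullback ρ.s (c4d • HigherVir.psi 1) =
      c4d • ((-1 / 2 : ℂ) • HigherVir.psi2d) := by
    rw [← ρ.pullback_psi_one]
    funext xs
    exact HigherVir.pullback_smul ρ.s c4d (HigherVir.psi 1) xs
  rw [h]
  constructor
  · intro h'
    obtain ⟨x, y, hxy⟩ := HigherVir.exists_psi2d_ne_zero
    have h1 := congrFun h' [x, y]
    simp only [Pi.smul_apply, smul_eq_mul] at h1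
    apply mul_right_cancel₀ hxy
    -- On a pair where `ψ_2d ≠ 0`, `h1` compares `-c4d / 2` with `c2d / 24`.
    linear_combination -24 * h1
  · rintro rfl
    rw [smul_smul, smul_smul]
    congr 1
    ring
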